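/- Let $G\subseteq U(n)$ be a compact group of unitary matrices with Lie algebra $\mathfrak g$, let $G^{\mathbb C}\subseteq GL(n,\mathbb C)$ be its complexification and $\mathfrak g^{\mathbb C}=\mathfrak g\oplus i\mathfrak g$. All loops are smooth maps on $S^1=\{|\lambda|=1\}$. Conventions. Let $\Omega G=\{\gamma:S^1\to G \mid \gamma(1)=e\}$, $\Lambda G^{\mathbb C}=\{\gamma:S^1\to G^{\mathbb C}\}$, let $\Lambda_+G^{\mathbb C}$ be the set of $\gamma\in\Lambda G^{\mathbb C}$ extending holomorphically to $|\lambda|<1$ with values in $G^{\mathbb C}$, let $\Lambda_+\mathfrak g^{\mathbb C}$ be defined likewise, and let $\Lambda_{-1,\infty}$ be the space of loops $\xi:S^1\to\mathfrak g^{\mathbb C}$ such that $\lambda\xi$ extends holomorphically to $|\lambda|<1$. For a $\Lambda_{-1,\infty}$-valued one-form $\mu$ on $\mathbb C$ with $d+\mu$ flat and with $(0,1)$-part valued in $\Lambda_+\mathfrak g^{\mathbb C}$ (the set of these forms is $\hat{\mathcal P}$), let $\Psi_\mu:\mathbb C\to\Lambda G^{\mathbb C}$ be the solution of $\Psi_\mu^{-1}d\Psi_\mu=\mu$,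 $\Psi_\mu(0)=e$, let $\Psi_\mu=\Phi_\mu b$ be the factorization with smooth $\Phi_\mu:\mathbb C\to\Omega G$ and $b:\mathbb C\to\Lambda_+G^{\mathbb C}$, and put $\phi_\mu(z)=\Phi_\mu(z)(-1)$. For a smooth $h:\mathbb C\to\Lambda G^{\mathbb C}$ put $h\cdot\mu=\mathrm{Ad}_h(\mu)-dh\,h^{-1}$, and let $S_\mu$ be the set of those $h$ for which $h\cdot\mu\in\hat{\mathcal P}$. For $d\in\mathbb N$ let $\Omega_d\mathfrak g$ be the set of loops $\eta:S^1\to\mathfrak g$ with $\eta(1)=0$ of the form $\eta=\sum_{|k|\le d}\eta_k\lambda^k$. A smooth map $\Phi:\mathbb C\to\Omega G$ is an extended solution if $\Phi^{-1}d\Phi=(1-\lambda^{-1})\alpha'+(1-\lambda)\alpha''$ for some $\mathfrak g^{\mathbb C}$-valued $(1,0)$-form $\alpha'$ with complex conjugate $\alpha''$. A harmonic map $\phi:\mathbb C\to G$ (with respect to a bi-invariant metric on $G$) is of finite type if there are an odd $d\in\mathbb N$ and $\eta\in\Omega_d\mathfrak g$ such that, for $\mu=\lambda^{d-1}\eta\,dz$,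 $\Phi_\mu$ is an extended solution and $\phi=\phi_\mu$. Theorem. Let $d\in\mathbb N$ be odd, $\eta\in\Omega_d\mathfrak g$, $\mu=\lambda^{d-1}\eta\,dz$, and let $\phi_\mu:\mathbb C\to G$ be the corresponding map of finite type. Let $\ell_0$ be a (constant) subspace of $\mathbb C^n$ with Hermitian projection $\pi_0$, and suppose that the loop $\gamma_{\ell_0}=\pi_0+\lambda^{-1}\pi_0^\perp$, regarded as a constant map $\mathbb C\to\Lambda G^{\mathbb C}$, belongs to $S_\mu$. Then the map $\phi_{\gamma_{\ell_0}\cdot\mu}$ exists, is uniquely determined, and is again a harmonic map of finite type. -/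

import Mathlib

open scoped Matrix ContDiff Matrix.Norms.L2Operator

noncomputable section

namespace LoopHarmonic

/-- Complex `n × n` matrices. (The operator norm in scope is only used to speak of derivatives.) -/
abbrev Mat (n : ℕ) := Matrix (Fin n) (Fin n) ℂ

/-! ### The group, its Lie algebra and their complexifications -/

/-- A group of unitary matrices, as a set of matrices. -/
def matrices {n : ℕ} (G : Subgroup (Matrix.unitaryGroup (Fin n) ℂ)) : Set (Mat n) :=
  {A | ∃ g ∈ G, (g : Mat n) = A}

/-- The Lie algebra `𝔤` of `G`. -/
def lieAlg {n : ℕ} (G : Subgroup (Matrix.unitaryGroup (Fin n) ℂ)) : Set (Mat n) :=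
  {X | ∀ t : ℝ, NormedSpace.exp ((t : ℂ) • X) ∈ matrices G}

/-- The complexified Lie algebra `𝔤 ⊗ ℂ = 𝔤 ⊕ i𝔤`. The sum is direct, as `𝔤` consists of
skew-Hermitian matrices. -/
def lieAlgC {n : ℕ} (G : Subgroup (Matrix.unitaryGroup (Fin n) ℂ)) : Set (Mat n) :=
  {Z | ∃ X ∈ lieAlg G, ∃ Y ∈ lieAlg G, Z = X + Complex.I • Y}

/-- The complexification of the compact matrix group `G`, realised as usual as the Zariski closure
of `G` in `GL(n, ℂ)`: the invertible matrices at which every polynomial in the matrix entries that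
vanishes on `G` vanishes. -/
def complexification {n : ℕ} (G : Subgroup (Matrix.unitaryGroup (Fin n) ℂ)) : Set (Mat n) :=
  {A | IsUnit A ∧ ∀ p : MvPolynomial (Fin n × Fin n) ℂ,
    (∀ g ∈ matrices G, MvPolynomial.eval (fun ij => g ij.1 ij.2) p = 0) →
      MvPolynomial.eval (fun ij => A ij.1 ij.2) p = 0}

/-! ### Loops and families of loops -/

/-- Families of loops `S¹ → Mat n` parametrised by `z ∈ ℂ`. -/
abbrev LoopFamily (n : ℕ) := ℂ → Circle → Mat n

/-- Smoothness of a map from `ℂ` to a space of smooth loops: joint smoothness in `z` and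
`λ = exp (i t)`. -/
def IsSmooth {n : ℕ} (F : LoopFamily n) : Prop :=
  ContDiff ℝ ∞ (fun p : ℂ × ℝ => F p.1 (Circle.exp p.2))

/-- `F` takes its values in the set `S`. -/
def TakesValuesIn {n : ℕ} (F : LoopFamily n) (S : Set (Mat n)) : Prop :=
  ∀ z l, F z l ∈ S

/-- The loop `γ` extends holomorphically to `|λ| < 1`, as a map with values in `S`. -/
def ExtendsToDisc {n : ℕ} (γ : Circle → Mat n) (S : Set (Mat n)) : Prop :=
  ∃ f : ℂ → Mat n, DiffContOnCl ℂ f (Metric.ball 0 1) ∧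
    (∀ w ∈ Metric.ball (0 : ℂ) 1, f w ∈ S) ∧ ∀ l : Circle, f (l : ℂ) = γ l

/-- `F` is a smooth map from `ℂ` to the loops in `S` (`ΛG^ℂ` or `Λ𝔤^ℂ`). -/
def IsInLoops {n : ℕ} (S : Set (Mat n)) (F : LoopFamily n) : Prop :=
  IsSmooth F ∧ TakesValuesIn F S

/-- `F` is a smooth map from `ℂ` to the loops in `S` which extend holomorphically to the disc
(`Λ₊G^ℂ` or `Λ₊𝔤^ℂ`). -/
def IsInPlusLoops {n : ℕ} (S : Set (Mat n)) (F : LoopFamily n) : Prop :=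
  IsInLoops S F ∧ ∀ z, ExtendsToDisc (F z) S

/-- `F` is a smooth map from `ℂ` to the based loop group `ΩG`. -/
def IsInBasedLoops {n : ℕ} (G : Subgroup (Matrix.unitaryGroup (Fin n) ℂ)) (F : LoopFamily n) :
    Prop :=
  IsInLoops (matrices G) F ∧ ∀ z, F z 1 = 1

/-- `F` is a smooth map from `ℂ` to `Λ_{-1,∞}`, the space of loops `ξ` in `𝔤^ℂ` such that `λ ξ`
extends holomorphically to the disc. -/
def IsInMinusOneLoops {n : ℕ} (G : Subgroup (Matrix.unitaryGroup (Fin n) ℂ)) (F : LoopFamily n) :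
    Prop :=
  IsInLoops (lieAlgC G) F ∧ ∀ z, ExtendsToDisc (fun l => (l : ℂ) • F z l) (lieAlgC G)

/-! ### One-forms -/

/-- The derivative `∂f/∂z`. -/
def dZ {n : ℕ} (f : ℂ → Mat n) (z : ℂ) : Mat n :=
  (1 / 2 : ℂ) • (fderiv ℝ f z 1 - Complex.I • fderiv ℝ f z Complex.I)

/-- The derivative `∂f/∂z̄`. -/
def dZbar {n : ℕ} (f : ℂ → Mat n) (z : ℂ) : Mat n :=
  (1 / 2 : ℂ) • (fderiv ℝ f z 1 + Complex.I • fderiv ℝ f z Complex.I)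

/-- A one-form `μ = zPart dz + zbarPart dz̄` on `ℂ` with values in the loops in `Mat n`, given by
the coefficients of its `(1,0)`-part and its `(0,1)`-part. -/
structure LoopForm (n : ℕ) where
  zPart : LoopFamily n
  zbarPart : LoopFamily n

/-- `μ` belongs to `P̂`: it takes values in `Λ_{-1,∞}`, the connection `d + μ` is flat, and the
`(0,1)`-part of `μ` takes values in `Λ₊𝔤^ℂ`. -/
def IsGeneralizedPotential {n : ℕ} (G : Subgroup (Matrix.unitaryGroup (Fin n) ℂ))
    (μ : LoopForm n) : Prop :=
  IsInMinusOneLoops G μ.zPart ∧ IsInMinusOneLoops G μ.zbarPart ∧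
  (∀ z l, dZ (fun w => μ.zbarPart w l) z - dZbar (fun w => μ.zPart w l) z
    + (μ.zPart z l * μ.zbarPart z l - μ.zbarPart z l * μ.zPart z l) = 0) ∧
  IsInPlusLoops (lieAlgC G) μ.zbarPart

/-- The gauge action `h · μ = Ad_h μ - dh h⁻¹`. -/
def gaugeAction {n : ℕ} (h : LoopFamily n) (μ : LoopForm n) : LoopForm n where
  zPart z l := h z l * μ.zPart z l * (h z l)⁻¹ - dZ (fun w => h w l) z * (h z l)⁻¹
  zbarPart z l := h z l * μ.zbarPart z l * (h z l)⁻¹ - dZbar (fun w => h w l) z * (h z l)⁻¹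

/-- The set `S_μ` of the gauge transformations `h : ℂ → ΛG^ℂ` with `h · μ ∈ P̂`. -/
def admissibleGauges {n : ℕ} (G : Subgroup (Matrix.unitaryGroup (Fin n) ℂ)) (μ : LoopForm n) :
    Set (LoopFamily n) :=
  {h | IsInLoops (complexification G) h ∧ IsGeneralizedPotential G (gaugeAction h μ)}

/-! ### Extended solutions and harmonic maps -/

/-- `Φ : ℂ → ΩG` is an extended solution: `Φ⁻¹dΦ = (1 - λ⁻¹) α' + (1 - λ) α''` with `α' = A dz`,
`A` valued in `𝔤^ℂ`. The conjugation of `𝔤^ℂ` with respect to `𝔤 ⊆ 𝔲(n)` is `X ↦ -Xᴴ`, so that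
`α'' = -Aᴴ dz̄`. -/
def IsExtendedSolution {n : ℕ} (G : Subgroup (Matrix.unitaryGroup (Fin n) ℂ))
    (Φ : LoopFamily n) : Prop :=
  IsInBasedLoops G Φ ∧ ∃ A : ℂ → Mat n, (∀ z, A z ∈ lieAlgC G) ∧
    ∀ (z : ℂ) (l : Circle),
      (Φ z l)⁻¹ * dZ (fun w => Φ w l) z = (1 - (l : ℂ)⁻¹) • A z ∧
      (Φ z l)⁻¹ * dZbar (fun w => Φ w l) z = (1 - (l : ℂ)) • (-(A z)ᴴ)

/-- `Ψ = Ψ_μ`: the map `Ψ : ℂ → ΛG^ℂ` with `Ψ⁻¹dΨ = μ` and `Ψ(0) = e`. -/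
def IsComplexExtendedSolutionOf {n : ℕ} (G : Subgroup (Matrix.unitaryGroup (Fin n) ℂ))
    (μ : LoopForm n) (Ψ : LoopFamily n) : Prop :=
  IsInLoops (complexification G) Ψ ∧ (∀ l, Ψ 0 l = 1) ∧
    ∀ (z : ℂ) (l : Circle),
      (Ψ z l)⁻¹ * dZ (fun w => Ψ w l) z = μ.zPart z l ∧
      (Ψ z l)⁻¹ * dZbar (fun w => Ψ w l) z = μ.zbarPart z l

/-- `Φ = Φ_μ`: the `ΩG`-factor in the Iwasawa factorization `Ψ_μ = Φ b`, `b : ℂ → Λ₊G^ℂ`. -/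
def IsIwasawaFactorOf {n : ℕ} (G : Subgroup (Matrix.unitaryGroup (Fin n) ℂ))
    (μ : LoopForm n) (Φ : LoopFamily n) : Prop :=
  IsInBasedLoops G Φ ∧ ∃ Ψ b : LoopFamily n, IsComplexExtendedSolutionOf G μ Ψ ∧
    IsInPlusLoops (complexification G) b ∧ ∀ z l, Ψ z l = Φ z l * b z l

/-- `φ = φ_μ`, that is, `φ(z) = Φ_μ(z)(-1)`. -/
def IsHarmonicMapOf {n : ℕ} (G : Subgroup (Matrix.unitaryGroup (Fin n) ℂ))
    (μ : LoopForm n) (φ : ℂ → Mat n) : Prop :=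
  ∃ Φ : LoopFamily n, IsIwasawaFactorOf G μ Φ ∧ ∀ z, φ z = Φ z (Circle.exp Real.pi)

/-- `φ : ℂ → G` is smooth and harmonic with respect to a bi-invariant metric of `G`, that is,
`d^*(φ⁻¹dφ) = 0`: `∂ₓ(φ⁻¹∂ₓφ) + ∂_y(φ⁻¹∂_yφ) = 0`. -/
def IsHarmonic {n : ℕ} (G : Subgroup (Matrix.unitaryGroup (Fin n) ℂ)) (φ : ℂ → Mat n) : Prop :=
  ContDiff ℝ ∞ φ ∧ (∀ z, φ z ∈ matrices G) ∧
    ∀ z, fderiv ℝ (fun w => (φ w)⁻¹ * fderiv ℝ φ w 1) z 1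
      + fderiv ℝ (fun w => (φ w)⁻¹ * fderiv ℝ φ w Complex.I) z Complex.I = 0

/-! ### Finite type -/

/-- `Ω_d 𝔤`: the loops `η : S¹ → 𝔤` with `η(1) = 0` of the form `η = ∑_{|k| ≤ d} η_k λ^k`. -/
def polynomialLoops {n : ℕ} (G : Subgroup (Matrix.unitaryGroup (Fin n) ℂ)) (d : ℕ) :
    Set (Circle → Mat n) :=
  {η | (∀ l, η l ∈ lieAlg G) ∧ η 1 = 0 ∧ ∃ c : ℤ → Mat n,
    ∀ l : Circle, η l = ∑ k ∈ Finset.Icc (-(d : ℤ)) (d : ℤ), (l : ℂ) ^ k • c k}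

/-- The constant potential `μ = λ^{d-1} η dz`. It is used for `d ≥ 1` only. -/
def finiteTypePotential {n : ℕ} (d : ℕ) (η : Circle → Mat n) : LoopForm n where
  zPart _ l := (l : ℂ) ^ (d - 1) • η l
  zbarPart _ _ := 0

/-- A harmonic map is of finite type if it is obtained from an extended solution `Φ_μ` with
`μ = λ^{d-1} η dz` for some odd `d` and some `η ∈ Ω_d 𝔤`. -/
def IsOfFiniteType {n : ℕ} (G : Subgroup (Matrix.unitaryGroup (Fin n) ℂ)) (φ : ℂ → Mat n) :
    Prop :=
  IsHarmonic G φ ∧ ∃ d : ℕ, Odd d ∧ ∃ η ∈ polynomialLoops G d, ∃ Φ : LoopFamily n,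
    IsExtendedSolution G Φ ∧ IsIwasawaFactorOf G (finiteTypePotential d η) Φ ∧
    ∀ z, φ z = Φ z (Circle.exp Real.pi)

/-- The matrix of the Hermitian projection of `ℂⁿ` onto the subspace `V`. -/
def hermitianProjection {n : ℕ} (V : Submodule ℂ (EuclideanSpace ℂ (Fin n))) : Mat n :=
  (Matrix.toEuclideanCLM (n := Fin n) (𝕜 := ℂ)).symm V.starProjection

/-- The loop `γ_V = π_V + λ⁻¹ π_V^⊥`, as a gauge transformation independent of `z`. -/
def unitonLoop {n : ℕ} (V : Submodule ℂ (EuclideanSpace ℂ (Fin n))) : LoopFamily n :=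
  fun _ l => hermitianProjection V + (l : ℂ)⁻¹ • (1 - hermitianProjection V)

end LoopHarmonic

end

open LoopHarmonic

noncomputable section

namespace LoopHarmonic

/-! Write `γ` for the loop of `ℓ₀`, `P` for its projection and `Ψ = Φ b` for the factorization
belonging to `μ`. Since `γ` does not depend on `z`, the solution for `γ · μ` is `γ Ψ γ⁻¹`. No
general factorization theorem is needed to split it: for any projection-valued `W(z)` with loop
`γ_W`, `γ Ψ γ⁻¹ = (γ Φ γ_W⁻¹)(γ_W b γ⁻¹)`. The second factor has at most a simple pole at `λ = 0`,
with residue `(1 - W) b(0) P`. It vanishes if `W(z)` projects onto the image of `ℓ₀` under `b(z)(0)`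
(`ExtendsToDisc.projLoop_mul_mul`, `exists_isIwasawaFactorOf_gaugeAction`).

The first factor must take values in `G` and not merely in `U(n)`, so `W` must be conjugate to `P`
under `G`: an orbit of the complexification through `P` is an orbit of `G`
(`exists_imageProjection_eq`). This uses polar decomposition inside the complexification
(`exists_polar`) and the fact that `G` is its unitary part (`mem_matrices_of_mem_complexification`),
which follows from Stone-Weierstrass and Haar averaging. Smoothness of `W` comes from a closed
formula for it and from the mean value property for `b(z)(0)`.

Uniqueness holds because a loop that extends to the disc together with its adjoint is constant
(`iwasawaFactor_unique`).

For finite type, `γ · μ = λ^{d-1} η' dz` with `η' = γ η γ⁻¹`. Conjugation might raise the degree to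
`d + 1`, but `γ ∈ S_μ` makes `λ^d η'` extend to the disc, and skew-Hermitian symmetry then bounds
the positive powers as well (`mem_polynomialLoops`). The Iwasawa factor is an extended solution by
comparison of powers of `λ` (`isExtendedSolution_of_isIwasawaFactorOf`), and its flatness for all
`λ` gives harmonicity (`IsExtendedSolution.isHarmonic`). -/

/-! ### Polynomials in the entries of a matrix -/

/-- The value at a matrix of a polynomial in the matrix entries. -/
def polyAt {n : ℕ} (p : MvPolynomial (Fin n × Fin n) ℂ) (A : Mat n) : ℂ :=
  MvPolynomial.eval (fun ij => A ij.1 ij.2) p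

lemma polyAt_bind₁ {n : ℕ} {σ : Type*} (p : MvPolynomial (Fin n × Fin n) ℂ)
    (Q : Fin n → Fin n → MvPolynomial σ ℂ) (x : σ → ℂ) :
    MvPolynomial.eval x (MvPolynomial.bind₁ (fun ij => Q ij.1 ij.2) p) =
      polyAt p (Matrix.of fun i j => MvPolynomial.eval x (Q i j)) := by
  exact MvPolynomial.eval₂Hom_bind₁ (RingHom.id ℂ) x (fun ij : Fin n × Fin n => Q ij.1 ij.2) p

lemma exists_polyAt_mul_left {n : ℕ} (p : MvPolynomial (Fin n × Fin n) ℂ) (B : Mat n) :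
    ∃ q, ∀ A, polyAt q A = polyAt p (B * A) := by
  refine ⟨MvPolynomial.bind₁ (fun ij => ∑ k, MvPolynomial.C (B ij.1 k) * MvPolynomial.X (k, ij.2)) p,
    fun A => ?_⟩
  rw [polyAt, polyAt_bind₁ p (fun i j => ∑ k, MvPolynomial.C (B i k) * MvPolynomial.X (k, j))]
  congr 1
  ext i j
  simp [Matrix.mul_apply]

lemma exists_polyAt_mul_right {n : ℕ} (p : MvPolynomial (Fin n × Fin n) ℂ) (B : Mat n) :
    ∃ q, ∀ A, polyAt q A = polyAt p (A * B) := by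
  refine ⟨MvPolynomial.bind₁ (fun ij => ∑ k, MvPolynomial.X (ij.1, k) * MvPolynomial.C (B k ij.2)) p,
    fun A => ?_⟩
  rw [polyAt, polyAt_bind₁ p (fun i j => ∑ k, MvPolynomial.X (i, k) * MvPolynomial.C (B k j))]
  congr 1
  ext i j
  simp [Matrix.mul_apply]

lemma exists_polyAt_conjTranspose {n : ℕ} (p : MvPolynomial (Fin n × Fin n) ℂ) :
    ∃ q, ∀ A : Mat n, polyAt q A = star (polyAt p Aᴴ) := by
  refine ⟨MvPolynomial.rename Prod.swap (MvPolynomial.map (starRingEnd ℂ) p), fun A => ?_⟩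
  simp only [polyAt, MvPolynomial.eval_rename, MvPolynomial.eval_map]
  have := MvPolynomial.eval₂_comp_left (starRingEnd ℂ) (RingHom.id ℂ)
    (fun ij : Fin n × Fin n => Aᴴ ij.1 ij.2) p
  rw [MvPolynomial.eval₂_id] at this
  rw [← starRingEnd_apply, this, RingHom.comp_id]
  congr 1
  ext ij
  simp [Matrix.conjTranspose_apply]

@[fun_prop]
lemma continuous_polyAt {n : ℕ} (p : MvPolynomial (Fin n × Fin n) ℂ) :
    Continuous (polyAt p) := by
  unfold polyAt
  refine (MvPolynomial.continuous_eval p).comp ?_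
  fun_prop

/-! ### The complexification -/

section
variable {n : ℕ} {G : Subgroup (Matrix.unitaryGroup (Fin n) ℂ)}

lemma mem_complexification_iff {A : Mat n} : A ∈ complexification G ↔ IsUnit A ∧
    ∀ p, (∀ g ∈ matrices G, polyAt p g = 0) → polyAt p A = 0 := Iff.rfl

lemma matrices_subset_complexification {A : Mat n} (hA : A ∈ matrices G) :
    A ∈ complexification G := by
  refine mem_complexification_iff.2 ⟨?_, fun p hp => hp A hA⟩
  obtain ⟨g, -, rfl⟩ := hA
  exact ⟨Unitary.toUnits g, rfl⟩

lemma mul_mem_matrices {A B : Mat n} (hA : A ∈ matrices G) (hB : B ∈ matrices G) :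
    A * B ∈ matrices G := by
  obtain ⟨g, hg, rfl⟩ := hA
  obtain ⟨h, hh, rfl⟩ := hB
  exact ⟨g * h, mul_mem hg hh, rfl⟩

lemma one_mem_matrices : (1 : Mat n) ∈ matrices G := ⟨1, one_mem _, rfl⟩

lemma conjTranspose_mem_matrices {A : Mat n} (hA : A ∈ matrices G) : Aᴴ ∈ matrices G := by
  obtain ⟨g, hg, rfl⟩ := hA
  exact ⟨g⁻¹, inv_mem hg, rfl⟩

lemma conjTranspose_mul_self_of_mem {A : Mat n} (hA : A ∈ matrices G) : Aᴴ * A = 1 := by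
  obtain ⟨g, hg, rfl⟩ := hA
  exact Matrix.UnitaryGroup.star_mul_self g

lemma mul_conjTranspose_self_of_mem {A : Mat n} (hA : A ∈ matrices G) : A * Aᴴ = 1 :=
  mul_eq_one_comm.1 (conjTranspose_mul_self_of_mem hA)

lemma inv_of_mem_matrices {A : Mat n} (hA : A ∈ matrices G) : A⁻¹ = Aᴴ :=
  Matrix.inv_eq_left_inv (conjTranspose_mul_self_of_mem hA)

lemma inv_mem_matrices {A : Mat n} (hA : A ∈ matrices G) : A⁻¹ ∈ matrices G := by
  rw [inv_of_mem_matrices hA]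
  exact conjTranspose_mem_matrices hA

/-- Zariski density is used once per factor: a polynomial translated by `B` on the right need only
be tested on `g ∈ G`, and there its translate by `g` on the left need only be tested on `G`. -/
lemma mul_mem_complexification {A B : Mat n} (hA : A ∈ complexification G)
    (hB : B ∈ complexification G) : A * B ∈ complexification G := by
  rw [mem_complexification_iff] at *
  refine ⟨hA.1.mul hB.1, fun p hp => ?_⟩
  obtain ⟨q, hq⟩ := exists_polyAt_mul_right p B
  rw [← hq]
  refine hA.2 q fun g hg => ?_
  rw [hq]
  obtain ⟨r, hr⟩ := exists_polyAt_mul_left p g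
  rw [← hr]
  refine hB.2 r fun g' hg' => ?_
  rw [hr]
  exact hp _ (mul_mem_matrices hg hg')

lemma conjTranspose_mem_complexification {A : Mat n} (hA : A ∈ complexification G) :
    Aᴴ ∈ complexification G := by
  rw [mem_complexification_iff] at *
  refine ⟨hA.1.star, fun p hp => ?_⟩
  obtain ⟨q, hq⟩ := exists_polyAt_conjTranspose p
  have := hA.2 q fun g hg => by
    rw [hq, hp _ (conjTranspose_mem_matrices hg), star_zero]
  rw [hq] at this
  exact star_eq_zero.1 this

lemma pow_mem_complexification {A : Mat n} (hA : A ∈ complexification G) (k : ℕ) :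
    A ^ k ∈ complexification G := by
  induction k with
  | zero => exact pow_zero A ▸ matrices_subset_complexification one_mem_matrices
  | succ k ih => exact pow_succ A k ▸ mul_mem_complexification ih hA

/-! ### Polar decomposition inside the complexification -/

/-- An exponential polynomial with positive real frequencies that vanishes at all natural numbers
vanishes at `-1/2`. -/
lemma eval_inv_eq_zero_of_eval_pow {σ : Type*} [Fintype σ] (q : MvPolynomial σ ℂ) (x : σ → ℝ)
    (hx : ∀ i, 0 < x i)
    (h : ∀ k : ℕ, MvPolynomial.eval (fun i => ((x i : ℂ) ^ 2) ^ k) q = 0) :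
    MvPolynomial.eval (fun i => (x i : ℂ)⁻¹) q = 0 := by
  classical
  set v : (σ →₀ ℕ) → ℝ := fun m => ∏ i, x i ^ m i with hv
  have hv0 : ∀ m, 0 < v m := fun m => Finset.prod_pos fun i _ => pow_pos (hx i) _
  set s : Finset ℂ := q.support.image fun m => ((v m : ℂ) ^ 2) with hs
  -- `r` is a polynomial with `r(v²) = v⁻¹` at every value `v` of a monomial of `q`. Distinct
  -- monomials may share a node, so the prescribed value is a function of the node alone. The sum in
  -- `key` is then a combination of the hypotheses for the various `k`.
  set r := Lagrange.interpolate s id (fun w : ℂ => ((Real.sqrt w.re : ℝ) : ℂ)⁻¹) with hr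
  have hrv : ∀ m ∈ q.support, r.eval ((v m : ℂ) ^ 2) = (v m : ℂ)⁻¹ := fun m hm => by
    have := Lagrange.eval_interpolate_at_node (s := s) (v := id) (i := ((v m : ℂ) ^ 2))
      (fun w : ℂ => ((Real.sqrt w.re : ℝ) : ℂ)⁻¹) Function.injective_id.injOn
      (Finset.mem_image_of_mem _ hm)
    rw [id] at this
    rw [hr, this, ← Complex.ofReal_pow, Complex.ofReal_re, Real.sqrt_sq (hv0 m).le]
  have key : ∑ m ∈ q.support, q.coeff m * r.eval ((v m : ℂ) ^ 2) = 0 := by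
    simp only [Polynomial.eval_eq_sum_range, Finset.mul_sum]
    rw [Finset.sum_comm]
    refine Finset.sum_eq_zero fun k _ => ?_
    have := h k
    rw [MvPolynomial.eval_eq'] at this
    rw [← mul_zero (r.coeff k), ← this, Finset.mul_sum]
    refine Finset.sum_congr rfl fun m _ => ?_
    rw [mul_left_comm]
    congr 2
    rw [hv]
    push_cast
    rw [← pow_mul, ← Finset.prod_pow]
    refine Finset.prod_congr rfl fun i _ => ?_
    ring
  rw [MvPolynomial.eval_eq', ← key]
  refine Finset.sum_congr rfl fun m hm => ?_
  rw [hrv m hm, hv]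
  push_cast
  simp [Finset.prod_inv_distrib]

/-- The matrix with eigenvalues `y` and the columns of `U` as eigenvectors. -/
def conjDiag (U : Mat n) (y : Fin n → ℂ) : Mat n := U * Matrix.diagonal y * Uᴴ

lemma conjDiag_mul {U : Mat n} (hU : Uᴴ * U = 1) (y y' : Fin n → ℂ) :
    conjDiag U y * conjDiag U y' = conjDiag U (y * y') := by
  calc conjDiag U y * conjDiag U y'
      = U * Matrix.diagonal y * (Uᴴ * U) * Matrix.diagonal y' * Uᴴ := by
        simp only [conjDiag, Matrix.mul_assoc]
    _ = conjDiag U (y * y') := by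
        rw [hU, Matrix.mul_one, Matrix.mul_assoc U, Matrix.diagonal_mul_diagonal]; rfl

lemma conjDiag_one {U : Mat n} (hU : U * Uᴴ = 1) : conjDiag U 1 = 1 := by
  change U * Matrix.diagonal (fun _ => (1 : ℂ)) * Uᴴ = 1
  rw [Matrix.diagonal_one, Matrix.mul_one, hU]

lemma conjDiag_pow {U : Mat n} (hU : Uᴴ * U = 1) (y : Fin n → ℂ) (k : ℕ) :
    conjDiag U y ^ k = conjDiag U (y ^ k) := by
  induction k with
  | zero => simpa using (conjDiag_one (mul_eq_one_comm.1 hU)).symm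
  | succ k ih => rw [pow_succ, ih, conjDiag_mul hU, pow_succ]

lemma conjDiag_conjTranspose (U : Mat n) (y : Fin n → ℂ) :
    (conjDiag U y)ᴴ = conjDiag U (star y) := by
  simp only [conjDiag, Matrix.conjTranspose_mul, Matrix.diagonal_conjTranspose,
    Matrix.conjTranspose_conjTranspose, Matrix.mul_assoc]

/-- The entries of `conjDiag U y` are linear in `y`. This turns membership of powers in the
complexification into the vanishing of exponential polynomials in the eigenvalues. -/
lemma exists_polyAt_conjDiag (p : MvPolynomial (Fin n × Fin n) ℂ) (U : Mat n) :
    ∃ q, ∀ y, MvPolynomial.eval y q = polyAt p (conjDiag U y) := by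
  refine ⟨MvPolynomial.bind₁ (fun ij : Fin n × Fin n =>
    ∑ k, MvPolynomial.C (U ij.1 k * Uᴴ k ij.2) * MvPolynomial.X k) p, fun y => ?_⟩
  rw [polyAt_bind₁ p (fun i j => ∑ k, MvPolynomial.C (U i k * Uᴴ k j) * MvPolynomial.X k)]
  congr 1
  ext i j
  simp only [conjDiag, Matrix.of_apply, map_sum, map_mul, MvPolynomial.eval_C, MvPolynomial.eval_X]
  rw [Matrix.mul_apply]
  simp only [Matrix.mul_diagonal]
  exact Finset.sum_congr rfl fun k _ => by ring

open scoped ComplexOrder in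
lemma exists_conjDiag_of_isUnit {h : Mat n} (hh : IsUnit h) :
    ∃ (U : Mat n) (x : Fin n → ℝ), Uᴴ * U = 1 ∧ (∀ i, 0 < x i) ∧
      hᴴ * h = conjDiag U (fun i => (x i : ℂ) ^ 2) := by
  have hM : (hᴴ * h).PosDef := Matrix.PosDef.conjTranspose_mul_self h
    (Matrix.mulVec_injective_iff_isUnit.2 hh)
  refine ⟨(hM.1.eigenvectorUnitary : Mat n), fun i => Real.sqrt (hM.1.eigenvalues i),
    Matrix.UnitaryGroup.star_mul_self hM.1.eigenvectorUnitary,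
    fun i => Real.sqrt_pos.2 (hM.eigenvalues_pos i), ?_⟩
  have := hM.1.spectral_theorem
  rw [Unitary.conjStarAlgAut_apply] at this
  refine this.trans ?_
  unfold conjDiag
  congr 3
  ext i
  rw [← Complex.ofReal_pow, Real.sq_sqrt (hM.eigenvalues_pos i).le]
  rfl

/-- The polar decomposition of an element `h` of the complexification: `h S` is unitary and `S` is
the inverse of a Hermitian matrix. -/
lemma exists_polar {h : Mat n} (hh : h ∈ complexification G) :
    ∃ R S : Mat n, Rᴴ = R ∧ S * R = 1 ∧ (h * S)ᴴ * (h * S) = 1 ∧ S ∈ complexification G := by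
  obtain ⟨U, x, hU, hx, hM⟩ := exists_conjDiag_of_isUnit hh.1
  have hMG := mul_mem_complexification (conjTranspose_mem_complexification hh) hh
  rw [hM] at hMG
  have hx' : ∀ i, (x i : ℂ) ≠ 0 := fun i => Complex.ofReal_ne_zero.2 (hx i).ne'
  have hSR : conjDiag U (fun i => (x i : ℂ)⁻¹) * conjDiag U (fun i => (x i : ℂ)) = 1 := by
    rw [conjDiag_mul hU, ← conjDiag_one (mul_eq_one_comm.1 hU)]
    congr 1
    ext i
    simp [hx' i]
  -- The `x i` are the singular values of `h`, so `R` is the positive square root of `hᴴ * h` and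
  -- `S` its inverse.
  refine ⟨conjDiag U fun i => (x i : ℂ), conjDiag U fun i => (x i : ℂ)⁻¹, ?_, hSR, ?_, ?_⟩
  · rw [conjDiag_conjTranspose]
    congr 1
    ext i
    simp
  · rw [Matrix.conjTranspose_mul, conjDiag_conjTranspose, Matrix.mul_assoc, ← Matrix.mul_assoc hᴴ,
      hM, conjDiag_mul hU, conjDiag_mul hU, ← conjDiag_one (mul_eq_one_comm.1 hU)]
    congr 1
    ext i
    have := hx' i
    simp
    field_simp
  · refine mem_complexification_iff.2 ⟨IsUnit.of_mul_eq_one _ hSR, fun p hp => ?_⟩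
    -- `S` is the power `-1/2` of `hᴴ * h`, all of whose natural powers lie in the complexification.
    obtain ⟨q, hq⟩ := exists_polyAt_conjDiag p U
    rw [← hq]
    refine eval_inv_eq_zero_of_eval_pow _ x hx fun k => ?_
    have := (pow_mem_complexification hMG k).2 p hp
    rw [conjDiag_pow hU] at this
    exact (hq _).trans this

/-- The torus orbit of an idempotent lies in the complexification as soon as the circle orbit
does. -/
lemma add_smul_mem_complexification {P : Mat n} (hP : P * P = P)
    (h : ∀ l : Circle, P + (l : ℂ) • (1 - P) ∈ complexification G) {w : ℂ} (hw : w ≠ 0) :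
    P + w • (1 - P) ∈ complexification G := by
  refine mem_complexification_iff.2 ⟨?_, fun p hp => ?_⟩
  · refine IsUnit.of_mul_eq_one (P + w⁻¹ • (1 - P)) ?_
    have h0 : P * (1 - P) = 0 := by rw [mul_sub, hP]; simp
    have h1 : (1 - P) * P = 0 := by rw [sub_mul, hP]; simp
    have h2 : (1 - P) * (1 - P) = 1 - P := by rw [sub_mul, h0]; simp
    simp [add_mul, mul_add, hP, h0, h1, h2, smul_smul, hw]
  -- Restricted to the line `w ↦ P + w • (1 - P)`, `p` is a polynomial in one variable that vanishes
  -- on the infinite unit circle, hence identically.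
  · let q : Polynomial ℂ := MvPolynomial.aeval
      (fun ij => Polynomial.C (P ij.1 ij.2) + Polynomial.X * Polynomial.C ((1 - P) ij.1 ij.2)) p
    have hq : ∀ w : ℂ, q.eval w = polyAt p (P + w • (1 - P)) := fun w => by
      have := MvPolynomial.comp_aeval (R := ℂ) (fun ij : Fin n × Fin n => Polynomial.C (P ij.1 ij.2)
        + Polynomial.X * Polynomial.C ((1 - P) ij.1 ij.2)) (Polynomial.aeval w)
      have h2 := DFunLike.congr_fun this p
      rw [AlgHom.comp_apply, Polynomial.coe_aeval_eq_eval] at h2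
      rw [show q.eval w = _ from h2, polyAt, MvPolynomial.aeval_eq_eval]
      change MvPolynomial.eval _ p = MvPolynomial.eval _ p
      congr 2
      ext ij
      simp
    have : q = 0 := by
      refine Polynomial.eq_zero_of_infinite_isRoot q ?_
      refine Set.Infinite.mono (s := Set.range ((↑) : Circle → ℂ)) ?_ ?_
      · rintro _ ⟨l, rfl⟩
        change q.eval _ = 0
        rw [hq]
        exact (h l).2 p hp
      · have : (Set.Icc (0 : ℝ) 1).Infinite := Set.Icc_infinite one_pos
        refine (this.image (f := fun t => (Circle.exp t : ℂ)) fun s hs t ht hst => ?_).mono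
          (Set.image_subset_iff.2 fun t _ => ⟨Circle.exp t, rfl⟩)
        exact Circle.exp_injOn_Icc (by linarith [Real.pi_gt_three]) hs ht (Circle.coe_injective hst)
    rw [← hq, this, Polynomial.eval_zero]

end

/-! ### Unitary matrices in the complexification -/

section
variable {n : ℕ} {G : Subgroup (Matrix.unitaryGroup (Fin n) ℂ)}

lemma norm_le_one_of_conjTranspose_mul_self {A : Mat n} (hA : Aᴴ * A = 1) : ‖A‖ ≤ 1 := by
  have h := CStarRing.norm_star_mul_self (x := A)
  rw [Matrix.star_eq_conjTranspose, hA] at h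
  rcases subsingleton_or_nontrivial (Mat n) with _ | _
  · rw [Subsingleton.elim A 0, norm_zero]; exact zero_le_one
  · rw [norm_one] at h
    nlinarith [norm_nonneg A]

instance compactSpace_unitaryGroup (n : ℕ) : CompactSpace (Matrix.unitaryGroup (Fin n) ℂ) := by
  refine isCompact_iff_compactSpace.1 (Metric.isCompact_of_isClosed_isBounded ?_ ?_)
  · have : (Matrix.unitaryGroup (Fin n) ℂ : Set (Mat n)) = {A | Aᴴ * A = 1} := by
      ext A
      exact Matrix.mem_unitaryGroup_iff'
    rw [this]
    exact isClosed_eq (by fun_prop) (by fun_prop)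
  · refine (Metric.isBounded_closedBall (x := (0 : Mat n)) (r := 1)).subset fun A hA => ?_
    rw [mem_closedBall_zero_iff]
    exact norm_le_one_of_conjTranspose_mul_self (Matrix.mem_unitaryGroup_iff'.1 hA)

lemma isCompact_matrices (hG : IsClosed (G : Set (Matrix.unitaryGroup (Fin n) ℂ))) :
    IsCompact (matrices G) := by
  have : matrices G = ((↑) : Matrix.unitaryGroup (Fin n) ℂ → Mat n) '' G := rfl
  rw [this]
  exact hG.isCompact.image continuous_subtype_val

/-! ### Representative functions on the unitary group -/

/-- The `(i, j)` entry as a continuous function on the unitary group. -/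
def entryMap (i j : Fin n) : C(Matrix.unitaryGroup (Fin n) ℂ, ℂ) where
  toFun u := (u : Mat n) i j
  continuous_toFun := continuous_subtype_val.matrix_elem i j

/-- The algebra of functions on the unitary group generated by the matrix entries and their
conjugates. -/
def entryAlgebra (n : ℕ) : StarSubalgebra ℂ C(Matrix.unitaryGroup (Fin n) ℂ, ℂ) :=
  StarAlgebra.adjoin ℂ {f | ∃ i j, entryMap i j = f}

lemma entryMap_mem (i j : Fin n) : entryMap i j ∈ entryAlgebra n :=
  StarAlgebra.subset_adjoin _ _ ⟨i, j, rfl⟩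

lemma entryAlgebra_induction {p : C(Matrix.unitaryGroup (Fin n) ℂ, ℂ) → Prop}
    (entry : ∀ i j, p (entryMap i j)) (entry_star : ∀ i j, p (star (entryMap i j)))
    (const : ∀ c : ℂ, p (algebraMap ℂ _ c)) (add : ∀ f g, p f → p g → p (f + g))
    (mul : ∀ f g, p f → p g → p (f * g)) {f : C(Matrix.unitaryGroup (Fin n) ℂ, ℂ)}
    (hf : f ∈ entryAlgebra n) : p f := by
  rw [entryAlgebra, ← StarSubalgebra.mem_toSubalgebra, StarAlgebra.adjoin_toSubalgebra] at hf
  refine Algebra.adjoin_induction (p := fun f _ => p f) ?_ const (fun f g _ _ => add f g)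
    (fun f g _ _ => mul f g) hf
  rintro f (⟨i, j, rfl⟩ | ⟨i, j, h⟩)
  · exact entry i j
  · rw [← star_star f, ← h]
    exact entry_star i j

/-- Stone-Weierstrass: the unitary group is compact and matrix entries separate its points. -/
lemma entryAlgebra_dense (f : C(Matrix.unitaryGroup (Fin n) ℂ, ℂ)) {ε : ℝ} (hε : 0 < ε) :
    ∃ g ∈ entryAlgebra n, ‖f - g‖ < ε := by
  have h : (entryAlgebra n).topologicalClosure = ⊤ := by
    refine ContinuousMap.starSubalgebra_topologicalClosure_eq_top_of_separatesPoints _ ?_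
    intro u v huv
    obtain ⟨i, j, hij⟩ : ∃ i j, (u : Mat n) i j ≠ (v : Mat n) i j := by
      by_contra! h
      exact huv (Subtype.ext (Matrix.ext h))
    exact ⟨entryMap i j, ⟨entryMap i j, entryMap_mem i j, rfl⟩, hij⟩
  have hf : f ∈ closure (entryAlgebra n : Set C(Matrix.unitaryGroup (Fin n) ℂ, ℂ)) := by
    rw [← StarSubalgebra.topologicalClosure_coe, h]
    trivial
  obtain ⟨g, hg, hfg⟩ := Metric.mem_closure_iff.1 hf ε hε
  exact ⟨g, hg, by rwa [dist_eq_norm] at hfg⟩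

/-- On unitary matrices the conjugate entries are entries of the inverse, that is, of the adjugate
divided by the determinant. A power of the determinant clears the denominators and leaves a
polynomial in the entries alone, the only kind that the complexification can test. -/
lemma exists_polyAt_eq_det_pow_mul {f : C(Matrix.unitaryGroup (Fin n) ℂ, ℂ)}
    (hf : f ∈ entryAlgebra n) :
    ∃ (N : ℕ) (p : MvPolynomial (Fin n × Fin n) ℂ), ∀ u : Matrix.unitaryGroup (Fin n) ℂ,
      polyAt p (u : Mat n) = (u : Mat n).det ^ N * f u := by
  set X : Matrix (Fin n) (Fin n) (MvPolynomial (Fin n × Fin n) ℂ) :=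
    Matrix.of fun i j => MvPolynomial.X (i, j) with hX
  have hXA : ∀ A : Mat n, (MvPolynomial.eval fun ij : Fin n × Fin n => A ij.1 ij.2).mapMatrix X
      = A := fun A => by
    ext i j
    simp [hX]
  have hdet : ∀ A : Mat n, polyAt X.det A = A.det := fun A => by
    rw [polyAt, RingHom.map_det, hXA]
  have hadj : ∀ (A : Mat n) i j, polyAt (X.adjugate i j) A = A.adjugate i j := fun A i j => by
    have := RingHom.map_adjugate (MvPolynomial.eval fun ij : Fin n × Fin n => A ij.1 ij.2) X
    rw [hXA] at this
    rw [← this]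
    rfl
  have hmul : ∀ p q (A : Mat n), polyAt (p * q) A = polyAt p A * polyAt q A := fun p q A =>
    map_mul _ _ _
  have hadd : ∀ p q (A : Mat n), polyAt (p + q) A = polyAt p A + polyAt q A := fun p q A =>
    map_add _ _ _
  have hpow : ∀ p k (A : Mat n), polyAt (p ^ k) A = polyAt p A ^ k := fun p k A =>
    map_pow _ _ _
  refine entryAlgebra_induction (p := fun f => ∃ (N : ℕ) (p : MvPolynomial (Fin n × Fin n) ℂ), ∀ u : Matrix.unitaryGroup (Fin n) ℂ,
      polyAt p (u : Mat n) = (u : Mat n).det ^ N * f u)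
    ?entry ?entry_star ?const ?add ?mul hf
  case entry =>
    intro i j
    exact ⟨0, MvPolynomial.X (i, j), fun u => by simp [polyAt, entryMap]⟩
  case entry_star =>
    intro i j
    refine ⟨1, X.adjugate j i, fun u => ?_⟩
    have h1 : (u : Mat n)ᴴ * (u : Mat n) = 1 := Matrix.UnitaryGroup.star_mul_self u
    have h2 : (u : Mat n).adjugate = (u : Mat n).det • (u : Mat n)ᴴ := by
      calc (u : Mat n).adjugate = (u : Mat n)ᴴ * ((u : Mat n) * (u : Mat n).adjugate) := by
            rw [← Matrix.mul_assoc, h1, Matrix.one_mul]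
        _ = _ := by rw [Matrix.mul_adjugate]; simp
    rw [hadj, h2, pow_one]
    rfl
  case const =>
    intro c
    exact ⟨0, MvPolynomial.C c, fun u => by simp [polyAt]⟩
  case add =>
    intro f g ihf ihg
    obtain ⟨N, p, hp⟩ := ihf
    obtain ⟨M, q, hq⟩ := ihg
    refine ⟨N + M, X.det ^ M * p + X.det ^ N * q, fun u => ?_⟩
    rw [hadd, hmul, hmul, hp, hq, hpow, hpow, hdet, ContinuousMap.add_apply]
    ring
  case mul =>
    intro f g ihf ihg
    obtain ⟨N, p, hp⟩ := ihf
    obtain ⟨M, q, hq⟩ := ihg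
    refine ⟨N + M, p * q, fun u => ?_⟩
    rw [hmul, hp, hq, ContinuousMap.mul_apply]
    ring

/-- Separating the variables lets an average over `v` act on the `b i` only, so the averaged
function stays in the algebra spanned by the `a i`. -/
lemma exists_sum_mul_of_mem_entryAlgebra {f : C(Matrix.unitaryGroup (Fin n) ℂ, ℂ)}
    (hf : f ∈ entryAlgebra n) :
    ∃ (ι : Type) (_ : Fintype ι) (a b : ι → C(Matrix.unitaryGroup (Fin n) ℂ, ℂ)),
      (∀ i, a i ∈ entryAlgebra n) ∧ ∀ u v, f (u * v) = ∑ i, a i u * b i v := by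
  refine entryAlgebra_induction (p := fun f => ∃ (ι : Type) (_ : Fintype ι) (a b : ι → C(Matrix.unitaryGroup (Fin n) ℂ, ℂ)),
      (∀ i, a i ∈ entryAlgebra n) ∧ ∀ u v, f (u * v) = ∑ i, a i u * b i v)
    ?entry ?entry_star ?const ?add ?mul hf
  case entry =>
    intro i j
    refine ⟨Fin n, inferInstance, fun k => entryMap i k, fun k => entryMap k j,
      fun k => entryMap_mem i k, fun u v => ?_⟩
    exact Matrix.mul_apply (M := (u : Mat n)) (N := (v : Mat n))
  case entry_star =>
    intro i j
    refine ⟨Fin n, inferInstance, fun k => star (entryMap i k), fun k => star (entryMap k j),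
      fun k => star_mem (entryMap_mem i k), fun u v => ?_⟩
    change star (((u : Mat n) * (v : Mat n)) i j) = _
    rw [Matrix.mul_apply, star_sum]
    exact Finset.sum_congr rfl fun k _ => star_mul' _ _
  case const =>
    intro c
    exact ⟨Unit, inferInstance, fun _ => algebraMap ℂ _ c, fun _ => 1,
      fun _ => algebraMap_mem _ _, fun u v => by simp⟩
  case add =>
    intro f g ihf ihg
    obtain ⟨ι, _, a, b, ha, hab⟩ := ihf
    obtain ⟨κ, _, c, d, hc, hcd⟩ := ihg
    refine ⟨ι ⊕ κ, inferInstance, Sum.elim a c, Sum.elim b d, ?_, fun u v => ?_⟩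
    · rintro (i | i)
      exacts [ha i, hc i]
    · simp [hab, hcd]
  case mul =>
    intro f g ihf ihg
    obtain ⟨ι, _, a, b, ha, hab⟩ := ihf
    obtain ⟨κ, _, c, d, hc, hcd⟩ := ihg
    refine ⟨ι × κ, inferInstance, fun i => a i.1 * c i.2, fun i => b i.1 * d i.2,
      fun i => mul_mem (ha _) (hc _), fun u v => ?_⟩
    rw [ContinuousMap.mul_apply, hab, hcd, Finset.sum_mul_sum, Fintype.sum_prod_type]
    refine Finset.sum_congr rfl fun i _ => Finset.sum_congr rfl fun j _ => ?_
    simp only [ContinuousMap.mul_apply]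
    ring

/-- Averaging over the right translates under `G`. -/
lemma exists_average (hG : IsClosed (G : Set (Matrix.unitaryGroup (Fin n) ℂ)))
    {f : C(Matrix.unitaryGroup (Fin n) ℂ, ℂ)} (hf : f ∈ entryAlgebra n) :
    ∃ F ∈ entryAlgebra n, ∃ c : ℂ, (∀ g ∈ G, F g = c) ∧
      ∀ (u : Matrix.unitaryGroup (Fin n) ℂ) (w : ℂ) (ε : ℝ),
        (∀ g ∈ G, ‖f (u * g) - w‖ ≤ ε) → ‖F u - w‖ ≤ ε := by
  let : MeasurableSpace G := borel G
  have : BorelSpace G := ⟨rfl⟩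
  have : CompactSpace G := isCompact_iff_compactSpace.1 hG.isCompact
  let μ : MeasureTheory.Measure G := MeasureTheory.Measure.haarMeasure ⊤
  have : MeasureTheory.IsProbabilityMeasure μ :=
    ⟨by simpa using MeasureTheory.Measure.haarMeasure_self (K₀ := (⊤ : TopologicalSpace.PositiveCompacts G))⟩
  have hint : ∀ b : C(Matrix.unitaryGroup (Fin n) ℂ, ℂ), ∀ u : Matrix.unitaryGroup (Fin n) ℂ,
      MeasureTheory.Integrable (fun g : G => b (u * g)) μ := fun b u => by
    have hc : Continuous fun g : G => b (u * g) := by fun_prop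
    exact hc.integrable_of_hasCompactSupport (HasCompactSupport.of_compactSpace _)
  obtain ⟨ι, _, a, b, ha, hab⟩ := exists_sum_mul_of_mem_entryAlgebra hf
  let F : C(Matrix.unitaryGroup (Fin n) ℂ, ℂ) := ∑ i, (∫ g : G, b i g ∂μ) • a i
  have hF : ∀ u, F u = ∫ g : G, f (u * g) ∂μ := fun u => by
    simp only [hab]
    rw [MeasureTheory.integral_finsetSum]
    · simp only [F, ContinuousMap.coe_sum, Finset.sum_apply, ContinuousMap.smul_apply, smul_eq_mul]
      exact Finset.sum_congr rfl fun i _ => by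
        rw [MeasureTheory.integral_const_mul, mul_comm]
    · intro i _
      simpa using (hint (b i) 1).const_mul (a i u)
  refine ⟨F, sum_mem fun i _ => SMulMemClass.smul_mem _ (ha i), ∫ g : G, f g ∂μ, fun g hg => ?_,
    fun u w ε h => ?_⟩
  · rw [hF]
    -- Invariance of Haar measure makes the average constant on `G`.
    exact MeasureTheory.integral_mul_left_eq_self (μ := μ) (fun x : G => f x) (⟨g, hg⟩ : G)
  · rw [hF]
    have h1 : ∫ g : G, f (u * g) ∂μ - w = ∫ g : G, (f (u * g) - w) ∂μ := by
      rw [MeasureTheory.integral_sub (hint f u) (MeasureTheory.integrable_const w)]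
      simp
    rw [h1]
    refine (MeasureTheory.norm_integral_le_of_norm_le_const (C := ε)
      (Filter.Eventually.of_forall fun g : G => h g g.2)).trans ?_
    simp

/-- A compact group is the unitary part of its complexification. -/
lemma mem_matrices_of_mem_complexification
    (hG : IsClosed (G : Set (Matrix.unitaryGroup (Fin n) ℂ))) {A : Mat n}
    (hA : A ∈ complexification G) (hu : Aᴴ * A = 1) : A ∈ matrices G := by
  set u : Matrix.unitaryGroup (Fin n) ℂ := ⟨A, Matrix.mem_unitaryGroup_iff'.2 hu⟩ with hudef
  by_contra hAG
  have huG : u ∉ G := fun h => hAG ⟨u, h, rfl⟩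
  -- If `u ∉ G`, a continuous function is `0` on `G` and `1` on the coset `u G`. Approximating it in
  -- the algebra and averaging gives `F`, constant and near `0` on `G` but near `1` at `u`. Up to a
  -- power of the determinant, `F - c` is a polynomial vanishing on `G`, hence also at `A`: a
  -- contradiction.
  obtain ⟨f, hf0, hf1, -⟩ := exists_continuous_zero_one_of_isClosed hG
    (t := (fun g => u * g) '' (G : Set (Matrix.unitaryGroup (Fin n) ℂ)))
    (hG.isCompact.image (by fun_prop)).isClosed (by
      rw [Set.disjoint_left]
      rintro _ hx ⟨g, hg, rfl⟩
      exact huG ((Subgroup.mul_mem_cancel_right G hg).1 hx))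
  let fC : C(Matrix.unitaryGroup (Fin n) ℂ, ℂ) := ⟨fun x => (f x : ℂ), by fun_prop⟩
  obtain ⟨q, hq, hfq⟩ := entryAlgebra_dense fC (ε := 1 / 4) (by norm_num)
  have hclose : ∀ x, ‖q x - f x‖ ≤ 1 / 4 := fun x => by
    rw [norm_sub_rev]
    exact ((fC - q).norm_coe_le_norm x).trans hfq.le
  obtain ⟨F, hF, c, hFc, hFw⟩ := exists_average hG hq
  have h0 : ‖c - 0‖ ≤ 1 / 4 := by
    rw [← hFc 1 (one_mem G)]
    refine hFw 1 0 _ fun g hg => ?_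
    have := hclose (1 * g)
    rwa [hf0 (by simpa using hg), Pi.zero_apply, Complex.ofReal_zero] at this
  have h1 : ‖F u - 1‖ ≤ 1 / 4 := by
    refine hFw u 1 _ fun g hg => ?_
    have := hclose (u * g)
    rwa [hf1 ⟨g, hg, rfl⟩, Pi.one_apply, Complex.ofReal_one] at this
  have hFu : F u = c := by
    obtain ⟨N, p, hp⟩ := exists_polyAt_eq_det_pow_mul
      (sub_mem hF (algebraMap_mem (entryAlgebra n) c))
    have hpA := hA.2 p (fun g hg => by
      obtain ⟨g, hg, rfl⟩ := hg
      refine (hp g).trans ?_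
      simp [hFc g hg])
    have h2 := (hp u).symm.trans hpA
    have hdet : A.det ≠ 0 := ((Matrix.isUnit_iff_isUnit_det A).1 hA.1).ne_zero
    simpa [hudef, hdet, sub_eq_zero] using h2
  rw [hFu] at h1
  have := norm_sub_le (c - 0) (c - 1)
  rw [show c - 0 - (c - 1) = 1 by ring, norm_one] at this
  linarith

/-! ### Moving a projection by an element of the complexification -/

/-- `g * P` need not be invertible, so it is approached by `g * (P + w • (1 - P))` with `w → 0`.
These have polar decompositions with unitary part in `G`; compactness of `G` yields a limit, and
being Hermitian is a closed condition. -/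
lemma exists_hermitian_factor (hG : IsClosed (G : Set (Matrix.unitaryGroup (Fin n) ℂ)))
    {g P : Mat n} (hg : g ∈ complexification G)
    (hP : ∀ w : ℂ, w ≠ 0 → P + w • (1 - P) ∈ complexification G) :
    ∃ k ∈ matrices G, (kᴴ * (g * P))ᴴ = kᴴ * (g * P) := by
  let w : ℕ → ℂ := fun m => 1 / ((m : ℂ) + 1)
  have hw : Filter.Tendsto w Filter.atTop (nhds 0) := tendsto_one_div_add_atTop_nhds_zero_nat
  have hw0 : ∀ m, w m ≠ 0 := fun m => by
    simp only [w]
    exact one_div_ne_zero (Nat.cast_add_one_ne_zero m)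
  have hex : ∀ m, ∃ k ∈ matrices G,
      (kᴴ * (g * (P + w m • (1 - P))))ᴴ = kᴴ * (g * (P + w m • (1 - P))) := fun m => by
    obtain ⟨R, S, hR, hSR, hu, hS⟩ :=
      exists_polar (mul_mem_complexification hg (hP (w m) (hw0 m)))
    set h := g * (P + w m • (1 - P))
    refine ⟨h * S, mem_matrices_of_mem_complexification hG
      (mul_mem_complexification (mul_mem_complexification hg (hP (w m) (hw0 m))) hS) hu, ?_⟩
    have : (h * S)ᴴ * h = R := by
      calc (h * S)ᴴ * h = (h * S)ᴴ * (h * (S * R)) := by rw [hSR, Matrix.mul_one]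
        _ = (h * S)ᴴ * (h * S) * R := by simp only [Matrix.mul_assoc]
        _ = R := by rw [hu, Matrix.one_mul]
    rw [this, hR]
  choose k hk hkR using hex
  obtain ⟨k₀, hk₀, φ, hφ, hlim⟩ := (isCompact_matrices hG).tendsto_subseq hk
  refine ⟨k₀, hk₀, ?_⟩
  let T : Mat n × ℂ → Mat n := fun x => x.1ᴴ * (g * (P + x.2 • (1 - P)))
  have hT : Continuous T := by fun_prop
  have hcl : IsClosed {x | (T x)ᴴ = T x} := isClosed_eq (by fun_prop) hT
  have hmem := hcl.mem_of_tendsto (hlim.prodMk_nhds (hw.comp hφ.tendsto_atTop))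
    (Filter.Eventually.of_forall fun m => hkR (φ m))
  simpa [T] using hmem

/-- For a Hermitian projection `P` and an invertible `g`, the Hermitian projection with the same
image as `g * P`. -/
def imageProjection (g P : Mat n) : Mat n :=
  g * P * (P * (gᴴ * g) * P + (1 - P))⁻¹ * (P * gᴴ)

-- For `v` in the kernel, applying `P` gives `(g * P)ᴴ * (g * P)` on `v` equal to zero, hence `P v =
-- 0`; applying `1 - P` gives `(1 - P) v = 0`.
open scoped ComplexOrder in
lemma isUnit_compression {g P : Mat n} (hg : IsUnit g) (hP : P * P = P) (hPH : Pᴴ = P) :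
    IsUnit (P * (gᴴ * g) * P + (1 - P)) := by
  rw [← Matrix.mulVec_injective_iff_isUnit]
  refine (injective_iff_map_eq_zero (Matrix.mulVecLin (P * (gᴴ * g) * P + (1 - P)))).2 fun v hv => ?_
  rw [Matrix.mulVecLin_apply] at hv
  have h0 : P * (1 - P) = 0 := by rw [mul_sub, hP]; simp
  have h1 : (1 - P) * P = 0 := by rw [sub_mul, hP]; simp
  have h2 : (1 - P) * (1 - P) = 1 - P := by rw [sub_mul, h0]; simp
  have hP1 : P *ᵥ ((P * (gᴴ * g) * P + (1 - P)) *ᵥ v) = ((g * P)ᴴ * (g * P)) *ᵥ v := by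
    rw [Matrix.mulVec_mulVec, Matrix.mul_add, h0, add_zero, Matrix.conjTranspose_mul, hPH]
    congr 1
    simp only [← Matrix.mul_assoc, hP]
  have hP2 : (1 - P) *ᵥ ((P * (gᴴ * g) * P + (1 - P)) *ᵥ v) = (1 - P) *ᵥ v := by
    rw [Matrix.mulVec_mulVec, Matrix.mul_add, h2]
    simp only [← Matrix.mul_assoc, h1, Matrix.zero_mul, zero_add]
  rw [hv, Matrix.mulVec_zero] at hP1 hP2
  have h3 : g *ᵥ (P *ᵥ v) = 0 := by
    rw [Matrix.mulVec_mulVec]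
    exact (Matrix.conjTranspose_mul_self_mulVec_eq_zero _ _).1 hP1.symm
  have h4 : P *ᵥ v = 0 := by
    apply Matrix.mulVec_injective_iff_isUnit.2 hg
    rw [h3, Matrix.mulVec_zero]
  rw [Matrix.sub_mulVec, Matrix.one_mulVec, h4, sub_zero] at hP2
  exact hP2.symm

/-- `G` acts transitively on the orbit of a projection `P` under the complexification. -/
lemma exists_imageProjection_eq (hG : IsClosed (G : Set (Matrix.unitaryGroup (Fin n) ℂ)))
    {g P : Mat n} (hg : g ∈ complexification G) (hPP : P * P = P) (hPH : Pᴴ = P)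
    (hP : ∀ w : ℂ, w ≠ 0 → P + w • (1 - P) ∈ complexification G) :
    ∃ k ∈ matrices G, imageProjection g P = k * P * kᴴ ∧ k * P * kᴴ * (g * P) = g * P := by
  obtain ⟨k, hk, hR⟩ := exists_hermitian_factor hG hg hP
  have hkk := conjTranspose_mul_self_of_mem hk
  have hkk' := mul_conjTranspose_self_of_mem hk
  -- `R` is Hermitian and `R = R * P`, so also `R = P * R`: it lives on the image of `P`. As `g * P
  -- = k * R` and `R * R + (1 - P)` is invertible, the image of `g * P` is exactly `k` applied to
  -- that of `P`.
  set R := kᴴ * (g * P) with hRdef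
  have hRP : R * P = R := by rw [hRdef]; simp only [Matrix.mul_assoc, hPP]
  have hPR : P * R = R := by
    have := congrArg Matrix.conjTranspose hRP
    rwa [Matrix.conjTranspose_mul, hR, hPH] at this
  have hgP : g * P = k * R := by rw [hRdef, ← Matrix.mul_assoc, hkk', Matrix.one_mul]
  have hPg : P * gᴴ = R * kᴴ := by
    have := congrArg Matrix.conjTranspose hgP
    rwa [Matrix.conjTranspose_mul, Matrix.conjTranspose_mul, hR, hPH] at this
  set N := P * (gᴴ * g) * P + (1 - P) with hN
  have hNR : N = R * R + (1 - P) := by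
    have : P * (gᴴ * g) * P = (P * gᴴ) * (g * P) := by simp only [Matrix.mul_assoc]
    rw [hN, this, hPg, hgP, Matrix.mul_assoc, ← Matrix.mul_assoc kᴴ, hkk, Matrix.one_mul]
  have hNu : N.det ≠ 0 := ((Matrix.isUnit_iff_isUnit_det _).1
    (isUnit_compression hg.1 hPP hPH)).ne_zero
  have hNinv : N⁻¹ * N = 1 := Matrix.nonsing_inv_mul _ (isUnit_iff_ne_zero.2 hNu)
  have hNinv' : N * N⁻¹ = 1 := mul_eq_one_comm.1 hNinv
  have hcomm : R * N = N * R := by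
    rw [hNR, Matrix.mul_add, Matrix.add_mul, Matrix.mul_sub, Matrix.sub_mul, hRP, hPR]
    simp [Matrix.mul_assoc]
  have hcomm' : N⁻¹ * R = R * N⁻¹ := by
    calc N⁻¹ * R = N⁻¹ * (R * N) * N⁻¹ := by
          rw [Matrix.mul_assoc, Matrix.mul_assoc R, hNinv', Matrix.mul_one]
      _ = N⁻¹ * N * R * N⁻¹ := by rw [hcomm]; simp only [Matrix.mul_assoc]
      _ = R * N⁻¹ := by rw [hNinv, Matrix.one_mul]
  have hQ : N⁻¹ * (1 - P) = 1 - P := by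
    have : N * (1 - P) = 1 - P := by
      have hq : (1 - P) * (1 - P) = 1 - P := by
        rw [sub_mul, mul_sub P, hPP]; simp
      rw [hNR, Matrix.add_mul, hq, Matrix.mul_assoc, Matrix.mul_sub, hRP]
      simp
    calc N⁻¹ * (1 - P) = N⁻¹ * (N * (1 - P)) := by rw [this]
      _ = 1 - P := by rw [← Matrix.mul_assoc, hNinv, Matrix.one_mul]
  refine ⟨k, hk, ?_, ?_⟩
  · rw [imageProjection, ← hN, hgP, hPg]
    have : R * N⁻¹ * R = P := by
      rw [← hcomm', Matrix.mul_assoc, show R * R = N - (1 - P) by rw [hNR]; simp, Matrix.mul_sub,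
        hNinv, hQ]
      simp
    rw [← this]
    simp only [Matrix.mul_assoc]
  · rw [hgP, Matrix.mul_assoc, ← Matrix.mul_assoc kᴴ, hkk, Matrix.one_mul, Matrix.mul_assoc, hPR]

end

/-! ### Loops that extend holomorphically to the disc -/

section
open Metric Filter
open scoped Topology

variable {E : Type*} [NormedAddCommGroup E] [NormedSpace ℂ E]

/-- The loop `γ` extends holomorphically to the unit disc. -/
def DiscExt (γ : Circle → E) : Prop :=
  ∃ f : ℂ → E, DiffContOnCl ℂ f (ball 0 1) ∧ ∀ l : Circle, f (l : ℂ) = γ l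

lemma closure_unitBall : closure (ball (0 : ℂ) 1) = closedBall 0 1 := closure_ball 0 one_ne_zero

lemma coe_mem_closedBall (l : Circle) : (l : ℂ) ∈ closedBall (0 : ℂ) 1 :=
  mem_closedBall_zero_iff.2 l.norm_coe.le

lemma discExt_const (c : E) : DiscExt fun _ => c := ⟨fun _ => c, diffContOnCl_const, fun _ => rfl⟩

lemma discExt_coe : DiscExt fun l : Circle => (l : ℂ) :=
  ⟨id, differentiable_id.diffContOnCl, fun _ => rfl⟩

lemma DiscExt.add {γ δ : Circle → E} (hγ : DiscExt γ) (hδ : DiscExt δ) :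
    DiscExt fun l => γ l + δ l := by
  obtain ⟨f, hf, hfγ⟩ := hγ
  obtain ⟨g, hg, hgδ⟩ := hδ
  exact ⟨f + g, hf.add hg, fun l => by rw [Pi.add_apply, hfγ, hgδ]⟩

lemma DiscExt.sub {γ δ : Circle → E} (hγ : DiscExt γ) (hδ : DiscExt δ) :
    DiscExt fun l => γ l - δ l := by
  obtain ⟨f, hf, hfγ⟩ := hγ
  obtain ⟨g, hg, hgδ⟩ := hδ
  exact ⟨f - g, hf.sub hg, fun l => by rw [Pi.sub_apply, hfγ, hgδ]⟩

lemma DiscExt.smul {h : Circle → ℂ} {γ : Circle → E} (hh : DiscExt h) (hγ : DiscExt γ) :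
    DiscExt fun l => h l • γ l := by
  obtain ⟨f, hf, hfγ⟩ := hh
  obtain ⟨g, hg, hgδ⟩ := hγ
  exact ⟨fun w => f w • g w, hf.smul hg, fun l => by simp only [hfγ, hgδ]⟩

lemma DiscExt.clm {F : Type*} [NormedAddCommGroup F] [NormedSpace ℂ F] (L : E →L[ℂ] F)
    {γ : Circle → E} (hγ : DiscExt γ) : DiscExt fun l => L (γ l) := by
  obtain ⟨f, hf, hfγ⟩ := hγ
  exact ⟨fun w => L (f w), ⟨L.differentiable.comp_differentiableOn hf.1,
    L.continuous.comp_continuousOn hf.2⟩, fun l => by simp only [hfγ]⟩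

lemma DiscExt.coe_smul {γ : Circle → E} (hγ : DiscExt γ) : DiscExt fun l => (l : ℂ) • γ l :=
  discExt_coe.smul hγ

lemma diffContOnCl_dslope {f : ℂ → E} [CompleteSpace E] (hf : DiffContOnCl ℂ f (ball 0 1)) :
    DiffContOnCl ℂ (dslope f 0) (ball 0 1) := by
  have h0 : ball (0 : ℂ) 1 ∈ 𝓝 0 := ball_mem_nhds 0 one_pos
  refine ⟨(Complex.differentiableOn_dslope h0).2 hf.1, ?_⟩
  exact (continuousOn_dslope (mem_of_superset h0 subset_closure)).2
    ⟨hf.2, hf.differentiableAt isOpen_ball (mem_ball_self one_pos)⟩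

/-- By the maximum principle, extensions that are uniformly Cauchy on the circle are so on the
closed disc. -/
lemma discExt_of_tendstoUniformly [CompleteSpace E] {γ : ℕ → Circle → E} {γ₀ : Circle → E}
    (h : ∀ m, DiscExt (γ m)) (hlim : TendstoUniformly γ γ₀ atTop) : DiscExt γ₀ := by
  choose f hf hfγ using h
  have hC : UniformCauchySeqOn f atTop (closedBall (0 : ℂ) 1) := by
    rw [Metric.uniformCauchySeqOn_iff]
    intro ε hε
    have hc := (tendstoUniformlyOn_univ.2 hlim).uniformCauchySeqOn
    obtain ⟨N, hN⟩ := Metric.uniformCauchySeqOn_iff.1 hc (ε / 2) (half_pos hε)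
    refine ⟨N, fun i hi j hj w hw => ?_⟩
    rw [dist_eq_norm]
    refine lt_of_le_of_lt ?_ (half_lt_self hε)
    refine Complex.norm_le_of_forall_mem_frontier_norm_le (f := f i - f j) isBounded_ball
      ((hf i).sub (hf j)) (fun z hz => ?_) (closure_unitBall ▸ hw)
    rw [frontier_ball 0 one_ne_zero, mem_sphere_zero_iff_norm] at hz
    let l : Circle := ⟨z, mem_sphere_zero_iff_norm.2 hz⟩
    have := hN i hi j hj l trivial
    rw [dist_eq_norm, ← hfγ, ← hfγ] at this
    exact this.le
  have hex : ∀ w ∈ closedBall (0 : ℂ) 1, ∃ y, Tendsto (fun m => f m w) atTop (𝓝 y) :=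
    fun w hw => cauchySeq_tendsto_of_complete (hC.cauchySeq hw)
  choose! F hF using hex
  have hT := hC.tendstoUniformlyOn_of_tendsto hF
  refine ⟨F, ⟨?_, ?_⟩, fun l => ?_⟩
  · exact (hT.mono ball_subset_closedBall).tendstoLocallyUniformlyOn.differentiableOn
      (Eventually.of_forall fun m => (hf m).1) isOpen_ball
  · rw [closure_unitBall]
    exact hT.continuousOn (Frequently.of_forall fun m => closure_unitBall ▸ (hf m).2)
  · refine tendsto_nhds_unique (hF l (coe_mem_closedBall l)) ?_
    simp only [hfγ]
    exact hlim.tendsto_at l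

lemma exists_mem_Icc_exp_eq (l : Circle) : ∃ t ∈ Set.Icc 0 (2 * Real.pi), Circle.exp t = l := by
  have hpi := Real.pi_pos
  by_cases h : 0 ≤ Complex.arg l
  · exact ⟨_, ⟨h, by linarith [Complex.arg_le_pi l]⟩, Circle.exp_arg l⟩
  · refine ⟨Complex.arg l + 2 * Real.pi, ⟨by linarith [Complex.neg_pi_lt_arg l], by linarith⟩, ?_⟩
    rw [Circle.exp_add_two_pi, Circle.exp_arg]

lemma circleMap_zero_one (t : ℝ) : circleMap 0 1 t = (Circle.exp t : ℂ) := by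
  simp [circleMap]

lemma integral_exp_eq [CompleteSpace E] {f : ℂ → E} (hf : DiffContOnCl ℂ f (ball 0 1)) :
    (2 * Real.pi)⁻¹ • ∫ t in (0 : ℝ)..2 * Real.pi, f (Circle.exp t : ℂ) = f 0 := by
  have := DiffContOnCl.circleAverage (f := f) (c := 0) (R := 1) (by simpa using hf)
  simpa only [Real.circleAverage_def, circleMap_zero_one] using this

/-- A loop that extends to the disc together with its conjugate is constant. -/
lemma DiscExt.eq_of_star {h : Circle → ℂ} (hh : DiscExt h) (hs : DiscExt fun l => star (h l))
    (l l' : Circle) : h l = h l' := by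
  obtain ⟨f, hf, hfh⟩ := hh
  obtain ⟨g, hg, hgh⟩ := hs
  suffices H : ∀ l, h l = f 0 by rw [H, H]
  intro l
  set c := f 0 with hc
  -- This product vanishes at `0` and equals `|h - c|²` on the circle, so the mean value property
  -- makes the integral of `|h - c|²` zero.
  have h1 : DiffContOnCl ℂ (fun w => (f w - c) • (g w - star c)) (ball 0 1) :=
    (hf.sub_const c).smul (hg.sub_const _)
  have h2 := integral_exp_eq h1
  have h3 : ∀ l : Circle, (f l - c) • (g l - star c) = ((‖h l - c‖ ^ 2 : ℝ) : ℂ) := fun l => by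
    rw [hfh, hgh, ← star_sub, smul_eq_mul, Complex.star_def, Complex.mul_conj,
      Complex.normSq_eq_norm_sq]
  have hcont : Continuous fun t : ℝ => h (Circle.exp t) := by
    simp only [← hfh]
    exact (closure_unitBall ▸ hf.2).comp_continuous (by fun_prop) fun t => coe_mem_closedBall _
  simp only [h3] at h2
  rw [intervalIntegral.integral_ofReal] at h2
  obtain ⟨t, ht, rfl⟩ := exists_mem_Icc_exp_eq l
  by_contra hne
  have hpos : 0 < ∫ t in (0 : ℝ)..2 * Real.pi, ‖h (Circle.exp t) - c‖ ^ 2 := by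
    refine intervalIntegral.integral_pos Real.two_pi_pos ((hcont.sub continuous_const).norm.pow 2).continuousOn
      (fun _ _ => by positivity)
      ⟨t, ht, ?_⟩
    have := norm_pos_iff.2 (sub_ne_zero.2 hne)
    positivity
  rw [hc, sub_self, zero_smul, smul_eq_zero] at h2
  rcases h2 with h2 | h2
  · exact (inv_ne_zero Real.two_pi_pos.ne') h2
  · exact hpos.ne' (Complex.ofReal_eq_zero.1 h2)

/-- A loop with only nonnegative powers of `λ` whose conjugate has only powers `≥ -m` is a
polynomial of degree at most `m`. -/
lemma DiscExt.exists_eq_sum {h : Circle → ℂ} {m : ℕ} (hh : DiscExt h)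
    (hs : DiscExt fun l => (l : ℂ) ^ m * star (h l)) :
    ∃ a : ℕ → ℂ, ∀ l : Circle, h l = ∑ k ∈ Finset.range (m + 1), (l : ℂ) ^ k * a k := by
  induction m generalizing h with
  | zero =>
    simp only [pow_zero, one_mul] at hs
    exact ⟨fun _ => h 1, fun l => by simpa using hh.eq_of_star hs l 1⟩
  | succ m ih =>
    obtain ⟨f, hf, hfh⟩ := hh
    -- Removing the constant term and dividing by `λ` keeps the extension and lowers `m` by one.
    have h1 : DiscExt fun l : Circle => (l : ℂ)⁻¹ * (h l - f 0) := by
      refine ⟨_, diffContOnCl_dslope hf, fun l => ?_⟩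
      rw [dslope_of_ne _ l.coe_ne_zero, slope_def_field, hfh, sub_zero, div_eq_inv_mul]
    have h2 : DiscExt fun l : Circle => (l : ℂ) ^ m * star ((l : ℂ)⁻¹ * (h l - f 0)) := by
      have hp : DiscExt fun l : Circle => (l : ℂ) ^ (m + 1) * star (f 0) :=
        ⟨fun w => w ^ (m + 1) * star (f 0),
          ((differentiable_pow _).mul_const _).diffContOnCl, fun _ => rfl⟩
      convert hs.sub hp using 2 with l
      rw [star_mul', star_sub, ← Circle.coe_inv, Circle.coe_inv_eq_conj, Complex.star_def,
        Complex.conj_conj]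
      ring
    obtain ⟨a, ha⟩ := ih h1 h2
    refine ⟨fun k => if k = 0 then f 0 else a (k - 1), fun l => ?_⟩
    rw [Finset.sum_range_succ']
    have h3 : h l = l * ((l : ℂ)⁻¹ * (h l - f 0)) + f 0 := by
      rw [mul_inv_cancel_left₀ l.coe_ne_zero]; ring
    rw [h3, ha, Finset.mul_sum]
    simp [pow_succ', mul_assoc]

end

/-! ### Matrix-valued loops -/

section
variable {n : ℕ}

/-- A matrix entry as a continuous linear map. -/
def entryCLM (i j : Fin n) : Mat n →L[ℂ] ℂ :=
  (Matrix.entryLinearMap ℂ ℂ i j).toContinuousLinearMap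

@[simp] lemma entryCLM_apply (i j : Fin n) (A : Mat n) : entryCLM i j A = A i j := rfl

lemma DiscExt.mul {γ δ : Circle → Mat n} (hγ : DiscExt γ) (hδ : DiscExt δ) :
    DiscExt fun l => γ l * δ l := by
  obtain ⟨f, hf, hfγ⟩ := hγ
  obtain ⟨g, hg, hgδ⟩ := hδ
  exact ⟨fun w => f w * g w, ⟨hf.1.mul hg.1, hf.2.mul hg.2⟩, fun l => by simp only [hfγ, hgδ]⟩

lemma DiscExt.matrix_eq_of_conjTranspose {γ : Circle → Mat n} (hγ : DiscExt γ)
    (hs : DiscExt fun l => (γ l)ᴴ) (l l' : Circle) : γ l = γ l' := by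
  ext i j
  exact (hγ.clm (entryCLM i j)).eq_of_star (hs.clm (entryCLM j i)) l l'

lemma DiscExt.matrix_exists_eq_sum {γ : Circle → Mat n} {m : ℕ} (hγ : DiscExt γ)
    (hs : DiscExt fun l => (l : ℂ) ^ m • (γ l)ᴴ) :
    ∃ A : ℕ → Mat n, ∀ l : Circle, γ l = ∑ k ∈ Finset.range (m + 1), (l : ℂ) ^ k • A k := by
  have h : ∀ i j, ∃ a : ℕ → ℂ, ∀ l : Circle,
      γ l i j = ∑ k ∈ Finset.range (m + 1), (l : ℂ) ^ k * a k := fun i j =>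
    (hγ.clm (entryCLM i j)).exists_eq_sum (hs.clm (entryCLM j i))
  choose A hA using h
  refine ⟨fun k => Matrix.of fun i j => A i j k, fun l => ?_⟩
  ext i j
  simp [hA, Matrix.sum_apply]

lemma ExtendsToDisc.discExt {γ : Circle → Mat n} {S : Set (Mat n)} (h : ExtendsToDisc γ S) :
    DiscExt γ := by
  obtain ⟨f, hf, -, hfγ⟩ := h
  exact ⟨f, hf, hfγ⟩

/-- Invertibility is needed on the closed disc: `S` supplies it inside through the extension and on
the boundary through the values of `γ`. -/
lemma DiscExt.inv {γ : Circle → Mat n} {S : Set (Mat n)} (hS : ∀ A ∈ S, IsUnit A)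
    (h : ExtendsToDisc γ S) (hγ : ∀ l, γ l ∈ S) : DiscExt fun l => (γ l)⁻¹ := by
  obtain ⟨f, hf, hfS, hfγ⟩ := h
  have hu : ∀ w ∈ closure (Metric.ball (0 : ℂ) 1), IsUnit (f w) := fun w hw => by
    rw [closure_unitBall, mem_closedBall_zero_iff] at hw
    rcases hw.lt_or_eq with hw | hw
    · exact hS _ (hfS w (mem_ball_zero_iff.2 hw))
    · have := hfγ ⟨w, mem_sphere_zero_iff_norm.2 hw⟩
      exact this ▸ hS _ (hγ _)
  refine ⟨fun w => Ring.inverse (f w), ⟨fun w hw => ?_, fun w hw => ?_⟩, fun l => ?_⟩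
  · obtain ⟨u, hu⟩ := hu w (subset_closure hw)
    have := (hasFDerivAt_ringInverse (𝕜 := ℂ) u).differentiableAt
    rw [hu] at this
    exact this.comp_differentiableWithinAt w (hf.1 w hw)
  · obtain ⟨u, hu⟩ := hu w hw
    have := (hasFDerivAt_ringInverse (𝕜 := ℂ) u).continuousAt
    rw [hu] at this
    exact this.comp_continuousWithinAt (hf.2 w hw)
  · simp only [hfγ]
    exact (Matrix.nonsing_inv_eq_ringInverse _).symm

/-! ### Smooth families of loops -/

lemma IsSmooth.slice {F : LoopFamily n} (hF : IsSmooth F) (l : Circle) :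
    ContDiff ℝ ∞ fun w => F w l := by
  obtain ⟨t, rfl⟩ := Circle.exp_surjective l
  exact hF.comp (contDiff_id.prodMk contDiff_const)

lemma IsSmooth.mul {F H : LoopFamily n} (hF : IsSmooth F) (hH : IsSmooth H) :
    IsSmooth fun z l => F z l * H z l := ContDiff.mul hF hH

lemma contDiff_matrix_inv {E : Type*} [NormedAddCommGroup E] [NormedSpace ℝ E] {f : E → Mat n}
    (hf : ContDiff ℝ ∞ f) (hu : ∀ x, IsUnit (f x)) : ContDiff ℝ ∞ fun x => (f x)⁻¹ := by
  simp only [Matrix.nonsing_inv_eq_ringInverse]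
  refine contDiff_iff_contDiffAt.2 fun x => ?_
  obtain ⟨u, hu⟩ := hu x
  have := contDiffAt_ringInverse ℝ (n := ∞) u
  rw [hu] at this
  exact this.comp x hf.contDiffAt

/-- The conjugate transpose as a real continuous linear map. -/
def conjTransposeCLM (n : ℕ) : Mat n →L[ℝ] Mat n :=
  LinearMap.toContinuousLinearMap
    { toFun := Matrix.conjTranspose
      map_add' := Matrix.conjTranspose_add
      map_smul' := fun c A => by simp [Matrix.conjTranspose_smul] }

lemma contDiff_conjTranspose {E : Type*} [NormedAddCommGroup E] [NormedSpace ℝ E] {f : E → Mat n}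
    (hf : ContDiff ℝ ∞ f) : ContDiff ℝ ∞ fun x => (f x)ᴴ :=
  (conjTransposeCLM n).contDiff.comp hf

-- The `z`-derivative is a limit of difference quotients, each of which extends. The limit is
-- uniform in `λ` because the derivative is uniformly continuous on a compact set of parameters.
open Filter in
lemma IsSmooth.discExt_fderiv {F : LoopFamily n} (hF : IsSmooth F) (hext : ∀ z, DiscExt (F z))
    (z v : ℂ) : DiscExt fun l => fderiv ℝ (fun w => F w l) z v := by
  set Fh : ℂ × ℝ → Mat n := fun p => F p.1 (Circle.exp p.2) with hFh
  set q : ℝ × ℝ → Mat n := fun p => fderiv ℝ Fh (z + (p.1 : ℂ) * v, p.2) (v, 0) with hq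
  have hqc : Continuous q := by
    have h1 : Continuous (fderiv ℝ Fh) := hF.continuous_fderiv (by simp)
    have h2 : Continuous fun p : ℝ × ℝ => (z + (p.1 : ℂ) * v, p.2) := by fun_prop
    exact (h1.comp h2).clm_apply continuous_const
  have hder : ∀ s t : ℝ, HasDerivAt (fun s : ℝ => Fh (z + (s : ℂ) * v, t)) (q (s, t)) s := by
    intro s t
    have h1 := (hF.differentiable (by simp) (z + (s : ℂ) * v, t)).hasFDerivAt
    have h2 : HasDerivAt (fun s : ℝ => (z + (s : ℂ) * v, t)) (v, 0) s := by
      refine HasDerivAt.prodMk ?_ (hasDerivAt_const s t)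
      have h3 : HasDerivAt (fun s : ℝ => (s : ℂ)) 1 s := Complex.ofRealCLM.hasDerivAt
      simpa using (h3.mul_const v).const_add z
    exact h1.comp_hasDerivAt s h2
  have hq0 : ∀ t : ℝ, fderiv ℝ (fun w => F w (Circle.exp t)) z v = q (0, t) := by
    intro t
    have h1 := ((hF.slice (Circle.exp t)).differentiable (by simp) (z + ((0 : ℝ) : ℂ) * v)).hasFDerivAt
    have h2 : HasDerivAt (fun s : ℝ => z + (s : ℂ) * v) v 0 := by
      have h3 : HasDerivAt (fun s : ℝ => (s : ℂ)) 1 0 := Complex.ofRealCLM.hasDerivAt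
      simpa using (h3.mul_const v).const_add z
    have h4 : HasDerivAt ((fun w => F w (Circle.exp t)) ∘ fun s : ℝ => z + (s : ℂ) * v)
      (q (0, t)) 0 := hder 0 t
    simpa using (h1.comp_hasDerivAt (0 : ℝ) h2).unique h4
  have hU := (isCompact_Icc (a := (0 : ℝ)) (b := 1)).prod
    (isCompact_Icc (a := (0 : ℝ)) (b := 2 * Real.pi)) |>.uniformContinuousOn_of_continuous
    hqc.continuousOn
  refine discExt_of_tendstoUniformly
    (γ := fun m l => (((m : ℝ) + 1 : ℝ) : ℂ) • (F (z + ((1 / ((m : ℝ) + 1) : ℝ) : ℂ) * v) l - F z l))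
    (fun m => (discExt_const _).smul ((hext _).sub (hext _))) ?_
  rw [Metric.tendstoUniformly_iff]
  intro ε hε
  obtain ⟨δ, hδ, hUδ⟩ := Metric.uniformContinuousOn_iff.1 hU (ε / 2) (half_pos hε)
  have hlim : Tendsto (fun m : ℕ => 1 / ((m : ℝ) + 1)) atTop (nhds 0) :=
    tendsto_one_div_add_atTop_nhds_zero_nat
  filter_upwards [hlim.eventually (gt_mem_nhds hδ)] with m hm l
  obtain ⟨t, ht, rfl⟩ := exists_mem_Icc_exp_eq l
  set s₀ : ℝ := 1 / ((m : ℝ) + 1) with hs₀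
  have hm0 : (0 : ℝ) < (m : ℝ) + 1 := by positivity
  have hs0 : 0 < s₀ := by positivity
  have hs1 : s₀ ≤ 1 := by
    rw [hs₀, div_le_one hm0]; linarith [(Nat.cast_nonneg m : (0 : ℝ) ≤ m)]
  -- Mean value inequality after subtracting the linear part, so that the derivative is `q (s, t) -
  -- q (0, t)`.
  have hmv : ‖(Fh (z + (s₀ : ℂ) * v, t) - s₀ • q (0, t)) -
      (Fh (z + ((0 : ℝ) : ℂ) * v, t) - (0 : ℝ) • q (0, t))‖ ≤ ε / 2 * ‖s₀ - 0‖ := by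
    refine Convex.norm_image_sub_le_of_norm_hasDerivWithin_le (s := Set.Icc 0 s₀)
      (f := fun s : ℝ => Fh (z + (s : ℂ) * v, t) - s • q (0, t))
      (f' := fun s => q (s, t) - q (0, t)) (fun s _ => ?_) (fun s hs => ?_) (convex_Icc 0 s₀)
      ⟨le_rfl, hs0.le⟩ ⟨hs0.le, le_rfl⟩
    · have := (hder s t).sub ((hasDerivAt_id s).smul_const (q (0, t)))
      rw [one_smul] at this
      exact this.hasDerivWithinAt
    · have := hUδ (s, t) ⟨⟨hs.1, hs.2.trans hs1⟩, ht⟩ (0, t) ⟨⟨le_rfl, zero_le_one⟩, ht⟩ (by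
        rw [Prod.dist_eq, dist_self, max_eq_left dist_nonneg, Real.dist_eq, sub_zero,
          abs_of_nonneg hs.1]
        exact hs.2.trans_lt hm)
      rw [dist_eq_norm] at this
      exact this.le
  rw [dist_comm, dist_eq_norm, hq0]
  have hcs : ∀ A : Mat n, (((m : ℝ) + 1 : ℝ) : ℂ) • A = ((m : ℝ) + 1) • A := fun A =>
    Complex.coe_smul _ A
  have hkey : (((m : ℝ) + 1 : ℝ) : ℂ) • (F (z + (s₀ : ℂ) * v) (Circle.exp t) - F z (Circle.exp t))
      - q (0, t) = ((m : ℝ) + 1) • ((Fh (z + (s₀ : ℂ) * v, t) - s₀ • q (0, t)) -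
      (Fh (z + ((0 : ℝ) : ℂ) * v, t) - (0 : ℝ) • q (0, t))) := by
    have h1 : ((m : ℝ) + 1) * s₀ = 1 := by rw [hs₀]; field_simp
    rw [hcs]
    simp only [hFh, Complex.ofReal_zero, zero_mul, add_zero, zero_smul, sub_zero, smul_sub,
      smul_smul, h1, one_smul]
    abel
  rw [hkey, norm_smul, Real.norm_of_nonneg hm0.le]
  calc ((m : ℝ) + 1) * _ ≤ ((m : ℝ) + 1) * (ε / 2 * ‖s₀ - 0‖) := by gcongr
    _ = ε / 2 := by
      rw [sub_zero, Real.norm_of_nonneg hs0.le, hs₀]; field_simp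
    _ < ε := half_lt_self hε

end

/-! ### Integrals depending smoothly on a parameter -/

section
open MeasureTheory

lemma hasFDerivAt_intervalIntegral_param {E : Type} [NormedAddCommGroup E] [NormedSpace ℝ E]
    [CompleteSpace E] {F : ℂ × ℝ → E} (hF : ContDiff ℝ 1 F) (a b : ℝ) (z : ℂ) :
    HasFDerivAt (fun z => ∫ t in a..b, F (z, t))
      (∫ t in a..b, (fderiv ℝ F (z, t)).comp (ContinuousLinearMap.inl ℝ ℂ ℝ)) z := by
  have hc : Continuous fun p : ℂ × ℝ => (fderiv ℝ F p).comp (ContinuousLinearMap.inl ℝ ℂ ℝ) :=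
    (hF.continuous_fderiv one_ne_zero).clm_comp continuous_const
  obtain ⟨C, hC⟩ := ((isCompact_closedBall z 1).prod (isCompact_uIcc (a := a) (b := b))).exists_bound_of_continuousOn
    hc.continuousOn
  have hF0 : ∀ z, Continuous fun t => F (z, t) := fun z => hF.continuous.comp (by fun_prop)
  have hc0 : Continuous fun t => (fderiv ℝ F (z, t)).comp (ContinuousLinearMap.inl ℝ ℂ ℝ) :=
    hc.comp (f := fun t : ℝ => (z, t)) (by fun_prop)
  refine intervalIntegral.hasFDerivAt_integral_of_dominated_of_fderiv_le
    (F' := fun z t => (fderiv ℝ F (z, t)).comp (ContinuousLinearMap.inl ℝ ℂ ℝ))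
    (s := Metric.closedBall z 1) (bound := fun _ => C)
    (Metric.closedBall_mem_nhds z one_pos) (Filter.Eventually.of_forall fun z =>
      (hF0 z).aestronglyMeasurable) ((hF0 z).intervalIntegrable _ _)
    hc0.aestronglyMeasurable (Filter.Eventually.of_forall fun t ht x hx => ?_)
    intervalIntegrable_const (Filter.Eventually.of_forall fun t _ x _ => ?_)
  · exact hC (x, t) ⟨hx, Set.uIoc_subset_uIcc ht⟩
  · have h1 := (hF.differentiable one_ne_zero (x, t)).hasFDerivAt
    exact h1.comp x (hasFDerivAt_prodMk_left x t)

/-- Induction on the order of differentiability. The target space must vary, as the derivative is an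
integral with values in linear maps. -/
lemma contDiff_intervalIntegral_param {E : Type} [NormedAddCommGroup E] [NormedSpace ℝ E]
    [CompleteSpace E] {F : ℂ × ℝ → E} (hF : ContDiff ℝ ∞ F) (a b : ℝ) :
    ContDiff ℝ ∞ fun z => ∫ t in a..b, F (z, t) := by
  refine contDiff_infty.2 fun m => ?_
  induction m generalizing E with
  | zero =>
    have hd := fun z => (hasFDerivAt_intervalIntegral_param (hF.of_le (by simp)) a b z).continuousAt
    exact contDiff_zero.2 (continuous_iff_continuousAt.2 hd)
  | succ m ih =>
    have hd := hasFDerivAt_intervalIntegral_param (hF.of_le (by simp)) a b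
    rw [show ((m + 1 : ℕ) : WithTop ℕ∞) = (m : WithTop ℕ∞) + 1 by push_cast; rfl]
    refine (contDiff_succ_iff_hasFDerivAt).2 ⟨_, ?_, hd⟩
    refine ih (F := fun p => (fderiv ℝ F p).comp (ContinuousLinearMap.inl ℝ ℂ ℝ)) ?_
    exact (hF.fderiv_right (m := ∞) (by simp)).clm_comp contDiff_const

end

/-! ### The Lie algebra of a closed group of unitary matrices -/

section
variable {n : ℕ} {G : Subgroup (Matrix.unitaryGroup (Fin n) ℂ)}

lemma smul_mem_lieAlg {X : Mat n} (hX : X ∈ lieAlg G) (r : ℝ) : (r : ℂ) • X ∈ lieAlg G := by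
  intro t
  have := hX (t * r)
  rwa [smul_smul, ← Complex.ofReal_mul]

lemma conj_mem_lieAlg {k X : Mat n} (hk : k ∈ matrices G) (hX : X ∈ lieAlg G) :
    k * X * kᴴ ∈ lieAlg G := by
  intro t
  have h1 : (t : ℂ) • (k * X * kᴴ) = k * ((t : ℂ) • X) * k⁻¹ := by
    rw [inv_of_mem_matrices hk]; simp
  rw [h1, Matrix.exp_conj _ _ (matrices_subset_complexification hk).1, inv_of_mem_matrices hk]
  exact mul_mem_matrices (mul_mem_matrices hk (hX t)) (conjTranspose_mem_matrices hk)

lemma hasDerivAt_exp_ofReal_smul (X : Mat n) :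
    HasDerivAt (fun t : ℝ => NormedSpace.exp ((t : ℂ) • X)) X 0 := by
  have h := hasDerivAt_exp_smul_const (𝕂 := ℂ) X 0
  rw [zero_smul, NormedSpace.exp_zero, one_mul] at h
  have h2 : HasDerivAt (fun s : ℝ => (s : ℂ)) 1 0 := Complex.ofRealCLM.hasDerivAt
  have h3 := HasDerivAt.scomp (0 : ℝ) (by simpa using h) h2
  rwa [one_smul] at h3

lemma conjTranspose_eq_neg_of_hasDerivAt {c : ℝ → Mat n} {X : Mat n}
    (hc : ∀ t, (c t)ᴴ * c t = 1) (h0 : c 0 = 1) (hd : HasDerivAt c X 0) : Xᴴ = -X := by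
  have h1 : HasDerivAt (fun t => (c t)ᴴ) Xᴴ 0 :=
    (conjTransposeCLM n).hasFDerivAt.comp_hasDerivAt (0 : ℝ) hd
  have h2 := h1.mul hd
  have h3 : (fun t => (c t)ᴴ) * c = fun _ => 1 := funext hc
  rw [h3, h0, Matrix.conjTranspose_one, mul_one, one_mul] at h2
  exact eq_neg_of_add_eq_zero_left (h2.unique (hasDerivAt_const (0 : ℝ) (1 : Mat n)))

lemma conjTranspose_of_mem_lieAlg {X : Mat n} (hX : X ∈ lieAlg G) : Xᴴ = -X :=
  conjTranspose_eq_neg_of_hasDerivAt (fun t => conjTranspose_mul_self_of_mem (hX t))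
    (by simp) (hasDerivAt_exp_ofReal_smul X)

/-- Telescoping, with every power of norm at most one; it controls the error in `exp (tX) = lim
c(t/m)^m`. -/
lemma norm_pow_sub_pow_le {a b : Mat n} (ha : aᴴ * a = 1) (hb : bᴴ * b = 1) (m : ℕ) :
    ‖a ^ m - b ^ m‖ ≤ m * ‖a - b‖ := by
  have hpow : ∀ m : ℕ, ‖a ^ m‖ ≤ 1 := fun m => by
    have : a ∈ unitary (Mat n) := Matrix.mem_unitaryGroup_iff'.2 ha
    exact norm_le_one_of_conjTranspose_mul_self (Matrix.mem_unitaryGroup_iff'.1 (pow_mem this m))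
  induction m with
  | zero => simp
  | succ m ih =>
    have h : a ^ (m + 1) - b ^ (m + 1) = a ^ m * (a - b) + (a ^ m - b ^ m) * b := by
      rw [pow_succ, pow_succ, mul_sub, sub_mul]; abel
    rw [h]
    calc _ ≤ ‖a ^ m‖ * ‖a - b‖ + ‖a ^ m - b ^ m‖ * ‖b‖ :=
          (norm_add_le _ _).trans (add_le_add (norm_mul_le _ _) (norm_mul_le _ _))
      _ ≤ 1 * ‖a - b‖ + (m * ‖a - b‖) * 1 := by
          gcongr
          exacts [hpow m, norm_le_one_of_conjTranspose_mul_self hb]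
      _ = _ := by push_cast; ring

open Filter in
/-- A velocity vector at the identity of a curve in `G` belongs to the Lie algebra. -/
lemma mem_lieAlg_of_hasDerivAt (hG : IsClosed (G : Set (Matrix.unitaryGroup (Fin n) ℂ)))
    {c : ℝ → Mat n} {X : Mat n} (hc : ∀ t, c t ∈ matrices G) (h0 : c 0 = 1)
    (hd : HasDerivAt c X 0) : X ∈ lieAlg G := by
  have hX : Xᴴ = -X :=
    conjTranspose_eq_neg_of_hasDerivAt (fun t => conjTranspose_mul_self_of_mem (hc t)) h0 hd
  have hexp : ∀ t : ℝ, (NormedSpace.exp ((t : ℂ) • X))ᴴ * NormedSpace.exp ((t : ℂ) • X) = 1 := by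
    intro t
    rw [← Matrix.exp_conjTranspose, Matrix.conjTranspose_smul, hX, Complex.star_def,
      Complex.conj_ofReal, smul_neg, Matrix.exp_neg]
    exact Matrix.nonsing_inv_mul _ ((Matrix.isUnit_iff_isUnit_det _).1 (Matrix.isUnit_exp _))
  intro t
  -- These elements of the closed group converge to `exp (tX)`, since `c` and the exponential agree
  -- to first order at `0`.
  have hcpow : ∀ m : ℕ, c (t / (m + 1)) ^ (m + 1) ∈ matrices G := fun m => by
    obtain ⟨g, hg, hgc⟩ := hc (t / (m + 1))
    exact ⟨g ^ (m + 1), pow_mem hg _, by rw [← hgc]; rfl⟩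
  refine (isCompact_matrices hG).isClosed.mem_of_tendsto (f := fun m : ℕ => c (t / (m + 1)) ^ (m + 1))
    (b := atTop) ?_ (Eventually.of_forall hcpow)
  rw [Metric.tendsto_nhds]
  intro ε hε
  have hdiff := hd.sub (hasDerivAt_exp_ofReal_smul X)
  rw [sub_self, hasDerivAt_iff_isLittleO] at hdiff
  have hpos : 0 < ε / (|t| + 1) := by positivity
  have hlim : Tendsto (fun m : ℕ => t / ((m : ℝ) + 1)) atTop (nhds 0) := by
    simpa [div_eq_mul_inv] using (tendsto_one_div_add_atTop_nhds_zero_nat (𝕜 := ℝ)).const_mul t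
  filter_upwards [hlim.eventually (hdiff.def hpos)] with m hm
  have hm0 : (0 : ℝ) < (m : ℝ) + 1 := by positivity
  have hpow : NormedSpace.exp ((t : ℂ) • X)
      = NormedSpace.exp (((t / (m + 1) : ℝ) : ℂ) • X) ^ (m + 1) := by
    rw [← Matrix.exp_nsmul]
    congr 1
    rw [← Nat.cast_smul_eq_nsmul ℂ, smul_smul]
    congr 1
    push_cast
    field_simp
  rw [dist_eq_norm, hpow]
  simp only [Pi.sub_apply, h0, Complex.ofReal_zero, zero_smul, NormedSpace.exp_zero, sub_self,
    sub_zero, smul_zero] at hm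
  calc _ ≤ ((m + 1 : ℕ) : ℝ) * ‖c (t / (m + 1)) - NormedSpace.exp (((t / (m + 1) : ℝ) : ℂ) • X)‖ :=
        norm_pow_sub_pow_le (conjTranspose_mul_self_of_mem (hc _)) (hexp _) _
    _ ≤ ((m + 1 : ℕ) : ℝ) * (ε / (|t| + 1) * ‖t / ((m : ℝ) + 1)‖) := by gcongr
    _ = ε * (|t| / (|t| + 1)) := by
      rw [norm_div, Real.norm_eq_abs, Real.norm_of_nonneg hm0.le]
      push_cast
      field_simp
    _ < ε := by
      refine mul_lt_of_lt_one_right hε ?_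
      rw [div_lt_one (by positivity)]
      linarith

lemma inv_mul_fderiv_mem_lieAlg (hG : IsClosed (G : Set (Matrix.unitaryGroup (Fin n) ℂ)))
    {f : ℂ → Mat n} (hf : Differentiable ℝ f) (hfG : ∀ z, f z ∈ matrices G) (z v : ℂ) :
    (f z)⁻¹ * fderiv ℝ f z v ∈ lieAlg G := by
  refine mem_lieAlg_of_hasDerivAt hG (c := fun s : ℝ => (f z)⁻¹ * f (z + (s : ℂ) * v))
    (fun t => mul_mem_matrices (inv_mem_matrices (hfG z)) (hfG _)) ?_ ?_
  · rw [inv_of_mem_matrices (hfG z), Complex.ofReal_zero, zero_mul, add_zero,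
      conjTranspose_mul_self_of_mem (hfG z)]
  · have h2 : HasDerivAt (fun s : ℝ => z + (s : ℂ) * v) v 0 := by
      have h3 : HasDerivAt (fun s : ℝ => (s : ℂ)) 1 0 := Complex.ofRealCLM.hasDerivAt
      simpa using (h3.mul_const v).const_add z
    have h1 : HasFDerivAt f (fderiv ℝ f z) (z + ((0 : ℝ) : ℂ) * v) := by
      simpa using (hf z).hasFDerivAt
    exact (h1.comp_hasDerivAt (0 : ℝ) h2).const_mul ((f z)⁻¹)

/-! ### Wirtinger derivatives -/

lemma dZ_add_dZbar (f : ℂ → Mat n) (z : ℂ) : dZ f z + dZbar f z = fderiv ℝ f z 1 := by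
  rw [dZ, dZbar, ← smul_add]
  rw [show ∀ a b : Mat n, a - b + (a + b) = (2 : ℂ) • a by intro a b; rw [two_smul]; abel,
    smul_smul]
  norm_num

lemma I_smul_dZ_sub_dZbar (f : ℂ → Mat n) (z : ℂ) :
    Complex.I • (dZ f z - dZbar f z) = fderiv ℝ f z Complex.I := by
  rw [dZ, dZbar, ← smul_sub]
  rw [show ∀ a b : Mat n, a - b - (a + b) = (-2 : ℂ) • b by intro a b; rw [neg_smul, two_smul]; abel,
    smul_smul, smul_smul, smul_smul]
  rw [show Complex.I * (1 / 2) * -2 * Complex.I = 1 by linear_combination -Complex.I_mul_I,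
    one_smul]

lemma fderiv_mul_apply {f g : ℂ → Mat n} {z : ℂ} (hf : DifferentiableAt ℝ f z)
    (hg : DifferentiableAt ℝ g z) (v : ℂ) :
    fderiv ℝ (fun w => f w * g w) z v = fderiv ℝ f z v * g z + f z * fderiv ℝ g z v := by
  rw [fderiv_fun_mul' hf hg, add_comm]
  rfl

lemma dZ_mul {f g : ℂ → Mat n} {z : ℂ} (hf : DifferentiableAt ℝ f z)
    (hg : DifferentiableAt ℝ g z) :
    dZ (fun w => f w * g w) z = dZ f z * g z + f z * dZ g z := by
  simp only [dZ, fderiv_mul_apply hf hg, smul_add,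
    smul_sub, sub_mul, mul_sub, Matrix.smul_mul, Matrix.mul_smul]
  abel

lemma dZbar_mul {f g : ℂ → Mat n} {z : ℂ} (hf : DifferentiableAt ℝ f z)
    (hg : DifferentiableAt ℝ g z) :
    dZbar (fun w => f w * g w) z = dZbar f z * g z + f z * dZbar g z := by
  simp only [dZbar, fderiv_mul_apply hf hg, smul_add, add_mul, mul_add, Matrix.smul_mul, Matrix.mul_smul]
  abel

lemma dZ_const (A : Mat n) (z : ℂ) : dZ (fun _ => A) z = 0 := by simp [dZ]

lemma dZbar_const (A : Mat n) (z : ℂ) : dZbar (fun _ => A) z = 0 := by simp [dZbar]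

lemma dZ_const_mul_mul_const {f : ℂ → Mat n} {z : ℂ} (hf : DifferentiableAt ℝ f z) (A B : Mat n) :
    dZ (fun w => A * f w * B) z = A * dZ f z * B := by
  rw [dZ_mul (f := fun w => A * f w) ((differentiableAt_const A).mul hf) (differentiableAt_const B),
    dZ_mul (differentiableAt_const A) hf, dZ_const, dZ_const, zero_mul, zero_add, mul_zero, add_zero]

lemma dZbar_const_mul_mul_const {f : ℂ → Mat n} {z : ℂ} (hf : DifferentiableAt ℝ f z)
    (A B : Mat n) : dZbar (fun w => A * f w * B) z = A * dZbar f z * B := by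
  rw [dZbar_mul (f := fun w => A * f w) ((differentiableAt_const A).mul hf)
      (differentiableAt_const B), dZbar_mul (differentiableAt_const A) hf, dZbar_const, dZbar_const,
    zero_mul, zero_add, mul_zero, add_zero]

lemma IsSmooth.discExt_dZ {F : LoopFamily n} (hF : IsSmooth F) (hext : ∀ z, DiscExt (F z))
    (z : ℂ) : DiscExt fun l => dZ (fun w => F w l) z :=
  (discExt_const _).smul ((hF.discExt_fderiv hext z 1).sub
    ((discExt_const _).smul (hF.discExt_fderiv hext z Complex.I)))

lemma IsSmooth.discExt_dZbar {F : LoopFamily n} (hF : IsSmooth F) (hext : ∀ z, DiscExt (F z))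
    (z : ℂ) : DiscExt fun l => dZbar (fun w => F w l) z :=
  (discExt_const _).smul ((hF.discExt_fderiv hext z 1).add
    ((discExt_const _).smul (hF.discExt_fderiv hext z Complex.I)))

lemma IsSmooth.differentiableAt {F : LoopFamily n} (hF : IsSmooth F) (l : Circle) (z : ℂ) :
    DifferentiableAt ℝ (fun w => F w l) z := (hF.slice l).differentiable (by simp) z

/-! ### Iwasawa factors are extended solutions -/

/-- The reality condition: the logarithmic derivatives in the real directions lie in the Lie
algebra, hence are skew-Hermitian. -/
lemma conjTranspose_dZ_logDeriv (hG : IsClosed (G : Set (Matrix.unitaryGroup (Fin n) ℂ)))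
    {f : ℂ → Mat n} (hf : Differentiable ℝ f) (hfG : ∀ z, f z ∈ matrices G) (z : ℂ) :
    ((f z)⁻¹ * dZbar f z)ᴴ = -((f z)⁻¹ * dZ f z) := by
  have h1 := conjTranspose_of_mem_lieAlg (inv_mul_fderiv_mem_lieAlg hG hf hfG z 1)
  have h2 := conjTranspose_of_mem_lieAlg (inv_mul_fderiv_mem_lieAlg hG hf hfG z Complex.I)
  simp only [dZ, dZbar, Matrix.mul_smul, Matrix.mul_add, Matrix.mul_sub, Matrix.conjTranspose_smul,
    Matrix.conjTranspose_add, h1, h2]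
  rw [← smul_neg]
  congr 1
  · simp
  · simp; abel

/-- The real factor is carried along because at `λ = -1` the form is `2 A`, and `r = 1 / 2` recovers
`A`. -/
lemma dZ_logDeriv_mem_lieAlgC (hG : IsClosed (G : Set (Matrix.unitaryGroup (Fin n) ℂ)))
    {f : ℂ → Mat n} (hf : Differentiable ℝ f) (hfG : ∀ z, f z ∈ matrices G) (z : ℂ) (r : ℝ) :
    (r : ℂ) • ((f z)⁻¹ * dZ f z) ∈ lieAlgC G := by
  refine ⟨_, smul_mem_lieAlg (inv_mul_fderiv_mem_lieAlg hG hf hfG z 1) (r / 2), _,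
    smul_mem_lieAlg (inv_mul_fderiv_mem_lieAlg hG hf hfG z Complex.I) (-r / 2), ?_⟩
  simp only [dZ, Matrix.mul_smul, Matrix.mul_sub, smul_smul, smul_sub]
  rw [sub_eq_add_neg, ← neg_smul]
  congr 2
  · push_cast; ring
  · push_cast; ring

/-- `Φ⁻¹dΦ` is the gauge transform of `μ` by `b`, so its `(0,1)`-part has no negative powers of `λ`
and its `(1,0)`-part none below `λ⁻¹`. The reality condition leaves only two terms in each part, and
`Φ = 1` at `λ = 1` makes them opposite. -/
lemma isExtendedSolution_of_isIwasawaFactorOf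
    (hG : IsClosed (G : Set (Matrix.unitaryGroup (Fin n) ℂ))) {μ : LoopForm n} {Φ : LoopFamily n}
    (hz : ∀ z, DiscExt fun l => (l : ℂ) • μ.zPart z l) (hzbar : ∀ z, DiscExt (μ.zbarPart z))
    (hΦ : IsIwasawaFactorOf G μ Φ) : IsExtendedSolution G Φ := by
  obtain ⟨⟨⟨hΦs, hΦG⟩, hΦ1⟩, Ψ, b, ⟨-, -, hΨμ⟩, ⟨⟨hbs, hbG⟩, hbext⟩, hΨ⟩ := hΦ
  have hbd : ∀ z, DiscExt (b z) := fun z => (hbext z).discExt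
  have hbinv : ∀ z, DiscExt fun l => (b z l)⁻¹ := fun z =>
    DiscExt.inv (fun A hA => hA.1) (hbext z) (hbG z)
  have hbu : ∀ z l, b z l * (b z l)⁻¹ = 1 := fun z l =>
    Matrix.mul_nonsing_inv _ ((Matrix.isUnit_iff_isUnit_det _).1 (hbG z l).1)
  have hbu' : ∀ z l, (b z l)⁻¹ * b z l = 1 := fun z l => mul_eq_one_comm.1 (hbu z l)
  have hΦu : ∀ z l, (Φ z l)⁻¹ * Φ z l = 1 := fun z l => by
    rw [inv_of_mem_matrices (hΦG z l), conjTranspose_mul_self_of_mem (hΦG z l)]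
  have hΨf : ∀ l, (fun w => Ψ w l) = fun w => Φ w l * b w l := fun l => funext fun w => hΨ w l
  -- the Maurer-Cartan forms of the two factors are gauge equivalent
  have key : ∀ (z : ℂ) (l : Circle) (D DΦ Db : Mat n), D = DΦ * b z l + Φ z l * Db →
      (Φ z l)⁻¹ * DΦ = b z l * ((Ψ z l)⁻¹ * D) * (b z l)⁻¹ - Db * (b z l)⁻¹ := by
    intro z l D DΦ Db hD
    have h1 : b z l * (Ψ z l)⁻¹ = (Φ z l)⁻¹ := by
      rw [hΨ, Matrix.mul_inv_rev, ← Matrix.mul_assoc, hbu, Matrix.one_mul]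
    rw [← Matrix.mul_assoc, h1, hD, Matrix.mul_add, Matrix.add_mul, ← Matrix.mul_assoc _ (Φ z l),
      hΦu, Matrix.one_mul, add_sub_cancel_right]
    simp only [Matrix.mul_assoc, hbu, Matrix.mul_one]
  have hω' : ∀ z l, (Φ z l)⁻¹ * dZ (fun w => Φ w l) z
      = b z l * μ.zPart z l * (b z l)⁻¹ - dZ (fun w => b w l) z * (b z l)⁻¹ := fun z l => by
    rw [← (hΨμ z l).1]
    refine key z l _ _ _ ?_
    rw [hΨf]
    exact dZ_mul (hΦs.differentiableAt l z) (hbs.differentiableAt l z)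
  have hω'' : ∀ z l, (Φ z l)⁻¹ * dZbar (fun w => Φ w l) z
      = b z l * μ.zbarPart z l * (b z l)⁻¹ - dZbar (fun w => b w l) z * (b z l)⁻¹ := fun z l => by
    rw [← (hΨμ z l).2]
    refine key z l _ _ _ ?_
    rw [hΨf]
    exact dZbar_mul (hΦs.differentiableAt l z) (hbs.differentiableAt l z)
  have hstar : ∀ z l, ((Φ z l)⁻¹ * dZbar (fun w => Φ w l) z)ᴴ
      = -((Φ z l)⁻¹ * dZ (fun w => Φ w l) z) := fun z l =>
    conjTranspose_dZ_logDeriv hG (fun w => hΦs.differentiableAt l w) (fun w => hΦG w l) z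
  have hext'' : ∀ z, DiscExt fun l => (Φ z l)⁻¹ * dZbar (fun w => Φ w l) z := fun z => by
    simp only [hω'']
    exact (((hbd z).mul (hzbar z)).mul (hbinv z)).sub ((hbs.discExt_dZbar hbd z).mul (hbinv z))
  have hext' : ∀ z, DiscExt fun l : Circle =>
      (l : ℂ) • ((Φ z l)⁻¹ * dZbar (fun w => Φ w l) z)ᴴ := fun z => by
    simp only [hstar, hω']
    have := ((hbs.discExt_dZ hbd z).mul (hbinv z)).coe_smul.sub
      (((hbd z).mul (hz z)).mul (hbinv z))
    convert this using 2 with l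
    rw [neg_sub, smul_sub, Matrix.mul_smul, Matrix.smul_mul]
  have hlin : ∀ z, ∃ A B : Mat n, ∀ l : Circle,
      (Φ z l)⁻¹ * dZbar (fun w => Φ w l) z = A + (l : ℂ) • B := fun z => by
    obtain ⟨A, hA⟩ := (hext'' z).matrix_exists_eq_sum (m := 1) (by simpa using hext' z)
    exact ⟨A 0, A 1, fun l => by rw [hA, Finset.sum_range_succ, Finset.sum_range_one]; simp⟩
  choose P Q hPQ using hlin
  have hPQ1 : ∀ z, Q z = -P z := fun z => by
    have h1 := hPQ z 1
    rw [show (fun w => Φ w 1) = fun _ => 1 from funext hΦ1, dZbar_const, Matrix.mul_zero] at h1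
    rw [Circle.coe_one, one_smul] at h1
    exact eq_neg_of_add_eq_zero_right h1.symm
  have hB : ∀ (z : ℂ) (l : Circle),
      (Φ z l)⁻¹ * dZbar (fun w => Φ w l) z = (1 - (l : ℂ)) • P z := fun z l => by
    rw [hPQ, hPQ1, smul_neg, sub_smul, one_smul, sub_eq_add_neg]
  have hA : ∀ (z : ℂ) (l : Circle),
      (Φ z l)⁻¹ * dZ (fun w => Φ w l) z = (1 - (l : ℂ)⁻¹) • (-(P z)ᴴ) := fun z l => by
    rw [← neg_inj, ← hstar, hB, Matrix.conjTranspose_smul, smul_neg, neg_neg]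
    congr 1
    rw [star_sub, star_one, ← Circle.coe_inv, Circle.coe_inv_eq_conj, Complex.star_def]
  refine ⟨⟨⟨hΦs, hΦG⟩, hΦ1⟩, fun z => -(P z)ᴴ, fun z => ?_, fun z l => ⟨hA z l, ?_⟩⟩
  · have h1 := hA z (Circle.exp Real.pi)
    have h2 := dZ_logDeriv_mem_lieAlgC hG (fun w => hΦs.differentiableAt (Circle.exp Real.pi) w)
      (fun w => hΦG w (Circle.exp Real.pi)) z (1 / 2)
    rw [h1, smul_smul] at h2
    convert h2 using 1
    rw [Circle.coe_exp, Complex.exp_pi_mul_I]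
    norm_num
  · rw [hB]
    simp

/-! ### Extended solutions give harmonic maps -/

lemma coe_exp_pi : ((Circle.exp Real.pi : Circle) : ℂ) = -1 := by
  rw [Circle.coe_exp, Complex.exp_pi_mul_I]

lemma coe_exp_pi_div_two : ((Circle.exp (Real.pi / 2) : Circle) : ℂ) = Complex.I := by
  rw [Circle.coe_exp]
  push_cast
  exact Complex.exp_pi_div_two_mul_I

lemma fderiv_fderiv_comm {f : ℂ → Mat n} (hf : ContDiff ℝ ∞ f) (z v w : ℂ) :
    fderiv ℝ (fun x => fderiv ℝ f x v) z w = fderiv ℝ (fun x => fderiv ℝ f x w) z v := by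
  have hd : DifferentiableAt ℝ (fderiv ℝ f) z :=
    (hf.fderiv_right (m := ∞) (by simp)).differentiable (by simp) z
  have hsymm : IsSymmSndFDerivAt ℝ f z := hf.contDiffAt.isSymmSndFDerivAt (by
    rw [minSmoothness_of_isRCLikeNormedField]; exact ENat.LEInfty.out)
  have h : ∀ v w, fderiv ℝ (fun x => fderiv ℝ f x v) z w = fderiv ℝ (fderiv ℝ f) z w v := by
    intro v w
    rw [fderiv_clm_apply hd (differentiableAt_const v)]
    simp
  rw [h, h, hsymm.eq]

/-- The structure equation of a map into the group. -/
lemma structure_equation {f a b : ℂ → Mat n} (hf : ContDiff ℝ ∞ f) (hu : ∀ z, IsUnit (f z))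
    (ha : Differentiable ℝ a) (hb : Differentiable ℝ b) (hfa : ∀ z, fderiv ℝ f z 1 = f z * a z)
    (hfb : ∀ z, fderiv ℝ f z Complex.I = f z * b z) (z : ℂ) :
    fderiv ℝ a z Complex.I - fderiv ℝ b z 1 = a z * b z - b z * a z := by
  have h := fderiv_fderiv_comm hf z 1 Complex.I
  simp only [hfa, hfb] at h
  have hd := hf.differentiable (by simp) z
  rw [fderiv_mul_apply hd (ha z), fderiv_mul_apply hd (hb z), hfa, hfb] at h
  simp only [Matrix.mul_assoc, ← Matrix.mul_add] at h
  have h2 := (hu z).mul_left_cancel h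
  rw [sub_eq_sub_iff_add_eq_add, add_comm, h2, add_comm]

/-- The structure equation holds for every `λ` and splits into two equations, with coefficients `1 -
λ⁻¹` and `1 - λ`. Subtracting these cancels the commutator and leaves the harmonic map equation. -/
lemma IsExtendedSolution.isHarmonic {Φ : LoopFamily n} (hΦ : IsExtendedSolution G Φ) :
    IsHarmonic G fun z => Φ z (Circle.exp Real.pi) := by
  obtain ⟨⟨⟨hΦs, hΦG⟩, hΦ1⟩, A, -, hA⟩ := hΦ
  have hΦu : ∀ z l, IsUnit (Φ z l) := fun z l => (matrices_subset_complexification (hΦG z l)).1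
  have hΦi : ∀ z l, Φ z l * (Φ z l)⁻¹ = 1 := fun z l =>
    Matrix.mul_nonsing_inv _ ((Matrix.isUnit_iff_isUnit_det _).1 (hΦu z l))
  -- Smoothness of `A` is not part of the definition; it is read off at `λ = -1`.
  have hAs : ContDiff ℝ ∞ A := by
    have h1 : A = fun z => (1 / 2 : ℂ) • ((Φ z (Circle.exp Real.pi))⁻¹
        * dZ (fun w => Φ w (Circle.exp Real.pi)) z) := funext fun z => by
      rw [(hA z _).1, coe_exp_pi, smul_smul]; norm_num
    have hs := hΦs.slice (Circle.exp Real.pi)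
    have hfd : ∀ v, ContDiff ℝ ∞ fun z => fderiv ℝ (fun w => Φ w (Circle.exp Real.pi)) z v :=
      fun v => (hs.fderiv_right (m := ∞) (by simp)).clm_apply contDiff_const
    rw [h1]
    refine ((contDiff_matrix_inv hs fun z => hΦu z _).mul ?_).const_smul (1 / 2 : ℂ)
    exact ((hfd 1).sub ((hfd Complex.I).const_smul Complex.I)).const_smul (1 / 2 : ℂ)
  set B : ℂ → Mat n := fun z => -(A z)ᴴ with hBdef
  have hBs : ContDiff ℝ ∞ B := (contDiff_conjTranspose hAs).neg
  have hAd : Differentiable ℝ A := hAs.differentiable (by simp)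
  have hBd : Differentiable ℝ B := hBs.differentiable (by simp)
  have hx : ∀ (l : Circle) z, (Φ z l)⁻¹ * fderiv ℝ (fun w => Φ w l) z 1
      = (1 - (l : ℂ)⁻¹) • A z + (1 - (l : ℂ)) • B z := fun l z => by
    rw [← dZ_add_dZbar, Matrix.mul_add, (hA z l).1, (hA z l).2]
  have hy : ∀ (l : Circle) z, (Φ z l)⁻¹ * fderiv ℝ (fun w => Φ w l) z Complex.I
      = Complex.I • ((1 - (l : ℂ)⁻¹) • A z - (1 - (l : ℂ)) • B z) := fun l z => by
    rw [← I_smul_dZ_sub_dZbar, Matrix.mul_smul, Matrix.mul_sub, (hA z l).1, (hA z l).2]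
  have hcancel : ∀ (l : Circle) z (X Y : Mat n), (Φ z l)⁻¹ * X = Y → X = Φ z l * Y := by
    rintro l z X _ rfl
    rw [← Matrix.mul_assoc, hΦi, Matrix.one_mul]
  have hpA : ∀ (p : ℂ), Differentiable ℝ fun w => p • A w := fun p => hAd.const_smul p
  have hqB : ∀ (q : ℂ), Differentiable ℝ fun w => q • B w := fun q => hBd.const_smul q
  have hfx : ∀ (p q : ℂ) z v, fderiv ℝ (fun w => p • A w + q • B w) z v
      = p • fderiv ℝ A z v + q • fderiv ℝ B z v := fun p q z v => by
    rw [fderiv_fun_add (hpA p z) (hqB q z), fderiv_fun_const_smul (hAd z),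
      fderiv_fun_const_smul (hBd z)]
    rfl
  have hfy : ∀ (p q : ℂ) z v, fderiv ℝ (fun w => Complex.I • (p • A w - q • B w)) z v
      = Complex.I • (p • fderiv ℝ A z v - q • fderiv ℝ B z v) := fun p q z v => by
    rw [fderiv_fun_const_smul ((hpA p z).fun_sub (hqB q z)),
      fderiv_fun_sub (hpA p z) (hqB q z), fderiv_fun_const_smul (hAd z),
      fderiv_fun_const_smul (hBd z)]
    rfl
  refine ⟨hΦs.slice _, fun z => hΦG z _, fun z => ?_⟩
  have hflat : ∀ l : Circle,
      (1 - (l : ℂ)⁻¹) • (fderiv ℝ A z Complex.I - Complex.I • fderiv ℝ A z 1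
        + (2 * Complex.I) • (A z * B z - B z * A z))
      + (1 - (l : ℂ)) • (fderiv ℝ B z Complex.I + Complex.I • fderiv ℝ B z 1
        + (2 * Complex.I) • (A z * B z - B z * A z)) = 0 := fun l => by
    have h := structure_equation (hΦs.slice l) (fun z => hΦu z l)
      (((hAd.const_smul (1 - (l : ℂ)⁻¹)).add (hBd.const_smul (1 - (l : ℂ)))))
      ((((hAd.const_smul (1 - (l : ℂ)⁻¹)).sub (hBd.const_smul (1 - (l : ℂ)))).const_smul Complex.I))
      (fun z => hcancel l z _ _ (hx l z)) (fun z => hcancel l z _ _ (hy l z)) z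
    have h1 := hfx (1 - (l : ℂ)⁻¹) (1 - (l : ℂ)) z Complex.I
    have h2 := hfy (1 - (l : ℂ)⁻¹) (1 - (l : ℂ)) z 1
    have hpq : (1 - (l : ℂ)⁻¹) * (1 - (l : ℂ)) = (1 - (l : ℂ)⁻¹) + (1 - (l : ℂ)) := by
      have := l.coe_ne_zero
      field_simp
      ring
    set p := 1 - (l : ℂ)⁻¹
    set q := 1 - (l : ℂ)
    have h3 := h1.symm.trans (sub_eq_iff_eq_add.1 h)
    have h4 : (p • A z + q • B z) * (Complex.I • (p • A z - q • B z))
        - Complex.I • (p • A z - q • B z) * (p • A z + q • B z)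
        = (-2 * Complex.I * (p + q)) • (A z * B z - B z * A z) := by
      rw [← hpq]
      simp only [Matrix.mul_smul, Matrix.smul_mul, Matrix.add_mul, Matrix.mul_add, Matrix.sub_mul,
        Matrix.mul_sub, smul_sub, smul_add, smul_smul]
      module
    have h5 : p • fderiv ℝ A z Complex.I + q • fderiv ℝ B z Complex.I
        = (-2 * Complex.I * (p + q)) • (A z * B z - B z * A z)
          + Complex.I • (p • fderiv ℝ A z 1 - q • fderiv ℝ B z 1) := by
      rw [← h2, ← h4]; exact h3
    have h6 := sub_eq_zero.2 h5
    rw [← h6]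
    module
  have e1 := hflat (Circle.exp Real.pi)
  have e2 := hflat (Circle.exp (Real.pi / 2))
  rw [coe_exp_pi] at e1
  rw [coe_exp_pi_div_two, Complex.inv_I] at e2
  simp only [hx, hy, hfx, hfy, coe_exp_pi]
  -- The coefficient pairs are `(1 + i, 1 - i)` at `λ = i` and `(2, 2)` at `λ = -1`, so this
  -- combination has the pair `(2i, -2i)`.
  have e3 := congrArg₂ (fun X Y => (2 : ℂ) • X - Y) e2 e1
  simp only [smul_zero, sub_zero] at e3
  rw [← e3]
  match_scalars <;> ring_nf <;> simp [Complex.I_sq]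

end

/-! ### The loops attached to projections -/

section
variable {n : ℕ} {G : Subgroup (Matrix.unitaryGroup (Fin n) ℂ)}

/-- The matrix acting as `1` on the image of the projection `P` and as `w` on its kernel. -/
def projLoop (P : Mat n) (w : ℂ) : Mat n := P + w • (1 - P)

lemma projLoop_mul {P : Mat n} (hP : P * P = P) (a b : ℂ) :
    projLoop P a * projLoop P b = projLoop P (a * b) := by
  have h0 : P * (1 - P) = 0 := by rw [mul_sub, hP]; simp
  have h1 : (1 - P) * P = 0 := by rw [sub_mul, hP]; simp
  have h2 : (1 - P) * (1 - P) = 1 - P := by rw [sub_mul, h0]; simp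
  simp [projLoop, add_mul, mul_add, hP, h0, h1, h2, smul_smul, mul_comm b]

@[simp] lemma projLoop_one (P : Mat n) : projLoop P 1 = 1 := by simp [projLoop]

lemma projLoop_conj (k P : Mat n) (hk : k * kᴴ = 1) (w : ℂ) :
    projLoop (k * P * kᴴ) w = k * projLoop P w * kᴴ := by
  simp [projLoop, Matrix.mul_add, Matrix.add_mul, Matrix.mul_sub, Matrix.sub_mul, hk]

lemma projLoop_inv_mul {P : Mat n} (hP : P * P = P) {w : ℂ} (hw : w ≠ 0) :
    projLoop P w⁻¹ * projLoop P w = 1 := by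
  rw [projLoop_mul hP, inv_mul_cancel₀ hw, projLoop_one]

lemma projLoop_mul_inv {P : Mat n} (hP : P * P = P) {w : ℂ} (hw : w ≠ 0) :
    projLoop P w * projLoop P w⁻¹ = 1 := by
  rw [projLoop_mul hP, mul_inv_cancel₀ hw, projLoop_one]

lemma projLoop_conjTranspose {P : Mat n} (hP : Pᴴ = P) (l : Circle) :
    (projLoop P (l : ℂ))ᴴ = projLoop P (l : ℂ)⁻¹ := by
  rw [projLoop, projLoop, Matrix.conjTranspose_add, Matrix.conjTranspose_smul,
    Matrix.conjTranspose_sub, hP, Matrix.conjTranspose_one, ← Circle.coe_inv,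
    Circle.coe_inv_eq_conj, Complex.star_def]

lemma hermitianProjection_mul_self (V : Submodule ℂ (EuclideanSpace ℂ (Fin n))) :
    hermitianProjection V * hermitianProjection V = hermitianProjection V := by
  rw [hermitianProjection, ← map_mul, V.isIdempotentElem_starProjection.eq]

lemma hermitianProjection_conjTranspose (V : Submodule ℂ (EuclideanSpace ℂ (Fin n))) :
    (hermitianProjection V)ᴴ = hermitianProjection V := by
  refine ((Matrix.toEuclideanCLM (n := Fin n) (𝕜 := ℂ)).symm.map_star' V.starProjection).symm.trans ?_
  rw [(isSelfAdjoint_starProjection V).star_eq]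
  rfl

lemma unitonLoop_eq (V : Submodule ℂ (EuclideanSpace ℂ (Fin n))) (z : ℂ) (l : Circle) :
    unitonLoop V z l = projLoop (hermitianProjection V) (l : ℂ)⁻¹ := rfl

/-- For a Hermitian projection the loop is unitary on the circle, and the unitary part of the
complexification is `G`. -/
lemma projLoop_mem_matrices (hG : IsClosed (G : Set (Matrix.unitaryGroup (Fin n) ℂ))) {P : Mat n}
    (hP : P * P = P) (hPH : Pᴴ = P) (h : ∀ l : Circle, projLoop P (l : ℂ) ∈ complexification G)
    (l : Circle) : projLoop P (l : ℂ) ∈ matrices G := by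
  refine mem_matrices_of_mem_complexification hG (h l) ?_
  rw [projLoop_conjTranspose hPH, projLoop_inv_mul hP l.coe_ne_zero]

lemma IsSmooth.projLoop {W : ℂ → Mat n} (hW : ContDiff ℝ ∞ W) :
    IsSmooth fun z l => projLoop (W z) (l : ℂ) := by
  have h1 : ContDiff ℝ ∞ fun p : ℂ × ℝ => ((Circle.exp p.2 : Circle) : ℂ) := by
    simp only [Circle.coe_exp]
    exact ((Complex.ofRealCLM.contDiff.comp contDiff_snd).mul contDiff_const).cexp
  have h2 : ContDiff ℝ ∞ fun p : ℂ × ℝ => W p.1 := hW.comp contDiff_fst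
  exact h2.add (h1.smul (contDiff_const.sub h2))

lemma IsSmooth.projLoop_inv {W : ℂ → Mat n} (hW : ContDiff ℝ ∞ W) :
    IsSmooth fun z l => LoopHarmonic.projLoop (W z) (l : ℂ)⁻¹ := by
  have h := (IsSmooth.projLoop hW).comp
    (contDiff_fst.prodMk contDiff_snd.neg : ContDiff ℝ ∞ fun p : ℂ × ℝ => (p.1, -p.2))
  have h2 : (fun p : ℂ × ℝ => LoopHarmonic.projLoop (W p.1) ((Circle.exp p.2 : Circle) : ℂ)⁻¹)
      = (fun p : ℂ × ℝ => LoopHarmonic.projLoop (W p.1) (Circle.exp p.2)) ∘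
        fun p : ℂ × ℝ => (p.1, -p.2) := by
    ext1 p
    rw [Function.comp_apply, ← Circle.coe_inv, ← Circle.exp_neg]
  unfold IsSmooth
  rw [h2]
  exact h

/-! ### Uniqueness of the Iwasawa factor -/

lemma fderiv_eq_of_logDeriv {f : ℂ → Mat n} {z : ℂ} {A B : Mat n} (hu : IsUnit (f z))
    (hA : (f z)⁻¹ * dZ f z = A) (hB : (f z)⁻¹ * dZbar f z = B) :
    fderiv ℝ f z 1 = f z * (A + B) ∧ fderiv ℝ f z Complex.I = f z * (Complex.I • (A - B)) := by
  have hi : f z * (f z)⁻¹ = 1 := Matrix.mul_nonsing_inv _ ((Matrix.isUnit_iff_isUnit_det _).1 hu)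
  rw [← dZ_add_dZbar, ← I_smul_dZ_sub_dZbar, ← hA, ← hB, ← mul_add, ← mul_sub, Matrix.mul_smul,
    ← mul_assoc, ← mul_assoc, hi, one_mul, one_mul]
  exact ⟨rfl, rfl⟩

lemma clm_eq_zero {E : Type*} [NormedAddCommGroup E] [NormedSpace ℝ E] {L : ℂ →L[ℝ] E}
    (h1 : L 1 = 0) (hI : L Complex.I = 0) : L = 0 := by
  ext1 v
  have hv : v = v.re • (1 : ℂ) + v.im • Complex.I := by
    simp [Complex.re_add_im]
  rw [hv, map_add, map_smul, map_smul, h1, hI]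
  simp

/-- The quotient `D = Ψ₁ * Ψ₂⁻¹` is constant: differentiating `D * Ψ₂ = Ψ₁` and using the common
logarithmic derivative gives `dD = 0`. -/
lemma complexExtendedSolution_unique {μ : LoopForm n} {Ψ₁ Ψ₂ : LoopFamily n}
    (h₁ : IsComplexExtendedSolutionOf G μ Ψ₁) (h₂ : IsComplexExtendedSolutionOf G μ Ψ₂)
    (z : ℂ) (l : Circle) : Ψ₁ z l = Ψ₂ z l := by
  obtain ⟨⟨hs₁, hG₁⟩, h0₁, hμ₁⟩ := h₁
  obtain ⟨⟨hs₂, hG₂⟩, h0₂, hμ₂⟩ := h₂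
  have hi : ∀ z, (Ψ₂ z l)⁻¹ * Ψ₂ z l = 1 := fun z =>
    Matrix.nonsing_inv_mul _ ((Matrix.isUnit_iff_isUnit_det _).1 (hG₂ z l).1)
  set D : ℂ → Mat n := fun z => Ψ₁ z l * (Ψ₂ z l)⁻¹ with hD
  have hDΨ : ∀ z, D z * Ψ₂ z l = Ψ₁ z l := fun z => by
    rw [hD]; simp only [mul_assoc, hi, mul_one]
  have hDd : Differentiable ℝ D :=
    ((hs₁.slice l).mul (contDiff_matrix_inv (hs₂.slice l) fun z => (hG₂ z l).1)).differentiable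
      (by simp)
  have hdir : ∀ z v (M : Mat n), fderiv ℝ (fun w => Ψ₁ w l) z v = Ψ₁ z l * M →
      fderiv ℝ (fun w => Ψ₂ w l) z v = Ψ₂ z l * M → fderiv ℝ D z v = 0 := by
    intro z v M e₁ e₂
    have h := fderiv_mul_apply (hDd z) (hs₂.differentiableAt l z) v
    simp only [hDΨ] at h
    rw [e₁, e₂, ← mul_assoc, hDΨ, right_eq_add] at h
    exact (hG₂ z l).1.mul_left_eq_zero.1 h
  have hD0 : ∀ z, fderiv ℝ D z = 0 := fun z => by
    obtain ⟨a₁, b₁⟩ := fderiv_eq_of_logDeriv (f := fun w => Ψ₁ w l) (hG₁ z l).1 (hμ₁ z l).1 (hμ₁ z l).2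
    obtain ⟨a₂, b₂⟩ := fderiv_eq_of_logDeriv (f := fun w => Ψ₂ w l) (hG₂ z l).1 (hμ₂ z l).1 (hμ₂ z l).2
    have e₁ := hdir z 1 _ a₁ a₂
    have e₂ := hdir z Complex.I _ b₁ b₂
    exact clm_eq_zero e₁ e₂
  have hc := is_const_of_fderiv_eq_zero (𝕜 := ℝ) hDd hD0 z 0
  have h1 : D 0 = 1 := by simp [hD, h0₁, h0₂]
  rw [← hDΨ z, hc, h1, one_mul]

/-- `Φ₂ᴴ * Φ₁ = b₂ * b₁⁻¹` extends to the disc, and so does its adjoint `b₁ * b₂⁻¹`. It is therefore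
constant in `λ`, and equal to `1` at `λ = 1`. -/
lemma iwasawaFactor_unique {μ : LoopForm n} {Φ₁ Φ₂ : LoopFamily n}
    (h₁ : IsIwasawaFactorOf G μ Φ₁) (h₂ : IsIwasawaFactorOf G μ Φ₂) (z : ℂ) (l : Circle) :
    Φ₁ z l = Φ₂ z l := by
  obtain ⟨⟨⟨-, hΦ₁⟩, e₁⟩, Ψ₁, b₁, hΨ₁, ⟨⟨-, hb₁⟩, hx₁⟩, hΨb₁⟩ := h₁
  obtain ⟨⟨⟨-, hΦ₂⟩, e₂⟩, Ψ₂, b₂, hΨ₂, ⟨⟨-, hb₂⟩, hx₂⟩, hΨb₂⟩ := h₂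
  have heq : ∀ l, Φ₁ z l * b₁ z l = Φ₂ z l * b₂ z l := fun l => by
    rw [← hΨb₁, ← hΨb₂, complexExtendedSolution_unique hΨ₁ hΨ₂]
  have hswap : ∀ {Φ₁ Φ₂ b₁ b₂ : Mat n}, Φ₂ ∈ matrices G → IsUnit b₁ → Φ₁ * b₁ = Φ₂ * b₂ →
      Φ₂ᴴ * Φ₁ = b₂ * b₁⁻¹ := by
    intro Φ₁ Φ₂ b₁ b₂ hΦ hb h
    have hi : b₁ * b₁⁻¹ = 1 :=
      Matrix.mul_nonsing_inv _ ((Matrix.isUnit_iff_isUnit_det _).1 hb)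
    calc Φ₂ᴴ * Φ₁ = Φ₂ᴴ * (Φ₁ * b₁) * b₁⁻¹ := by simp only [mul_assoc, hi, mul_one]
      _ = b₂ * b₁⁻¹ := by
        rw [h, ← mul_assoc, conjTranspose_mul_self_of_mem hΦ, one_mul]
  have hX : DiscExt fun l => (Φ₂ z l)ᴴ * Φ₁ z l := by
    simp only [fun l => hswap (hΦ₂ z l) (hb₁ z l).1 (heq l)]
    exact (hx₂ z).discExt.mul (DiscExt.inv (fun A hA => hA.1) (hx₁ z) (hb₁ z))
  have hX' : DiscExt fun l => ((Φ₂ z l)ᴴ * Φ₁ z l)ᴴ := by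
    simp only [Matrix.conjTranspose_mul, Matrix.conjTranspose_conjTranspose,
      fun l => hswap (hΦ₁ z l) (hb₂ z l).1 (heq l).symm]
    exact (hx₁ z).discExt.mul (DiscExt.inv (fun A hA => hA.1) (hx₂ z) (hb₂ z))
  have h1 := hX.matrix_eq_of_conjTranspose hX' l 1
  simp only [e₁, e₂, Matrix.conjTranspose_one, one_mul] at h1
  calc Φ₁ z l = Φ₂ z l * ((Φ₂ z l)ᴴ * Φ₁ z l) := by
        rw [← mul_assoc, mul_conjTranspose_self_of_mem (hΦ₂ z l), one_mul]
    _ = Φ₂ z l := by rw [h1, mul_one]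

/-! ### The transformed potential -/

lemma gaugeAction_unitonLoop (V : Submodule ℂ (EuclideanSpace ℂ (Fin n))) (d : ℕ)
    (η : Circle → Mat n) :
    gaugeAction (unitonLoop V) (finiteTypePotential d η) = finiteTypePotential d fun l =>
      projLoop (hermitianProjection V) (l : ℂ)⁻¹ * η l * projLoop (hermitianProjection V) (l : ℂ) := by
  have hinv : ∀ l : Circle, (projLoop (hermitianProjection V) (l : ℂ)⁻¹)⁻¹
      = projLoop (hermitianProjection V) (l : ℂ) := fun l =>
    Matrix.inv_eq_right_inv (projLoop_inv_mul (hermitianProjection_mul_self V) l.coe_ne_zero)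
  simp only [gaugeAction, finiteTypePotential, unitonLoop_eq, dZ_const, dZbar_const, hinv]
  congr 1
  · ext1 z
    ext1 l
    simp
  · ext1 z
    ext1 l
    simp

/-- As `η` is skew-Hermitian, `λ^{2d} (λ^d η)ᴴ = -λ^d η`, so the one-sided bound on the powers of
`λ` in `η` forces the bound on the other side. -/
lemma mem_polynomialLoops {η : Circle → Mat n} {d : ℕ} (hη : ∀ l, η l ∈ lieAlg G) (h1 : η 1 = 0)
    (hext : DiscExt fun l : Circle => (l : ℂ) ^ d • η l) : η ∈ polynomialLoops G d := by
  have hs : DiscExt fun l : Circle => (l : ℂ) ^ (2 * d) • ((l : ℂ) ^ d • η l)ᴴ := by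
    convert (discExt_const (-1 : ℂ)).smul hext using 2 with l
    rw [Matrix.conjTranspose_smul, conjTranspose_of_mem_lieAlg (hη l), smul_smul, smul_smul,
      smul_neg, ← neg_smul]
    congr 1
    have hl : (l : ℂ) * star (l : ℂ) = 1 := by
      rw [Complex.star_def, Complex.mul_conj, Circle.normSq_coe, Complex.ofReal_one]
    have hl' : (l : ℂ) ^ d * star (l : ℂ) ^ d = 1 := by rw [← mul_pow, hl, one_pow]
    rw [star_pow]
    linear_combination (-(l : ℂ) ^ d) * hl'
  obtain ⟨A, hA⟩ := hext.matrix_exists_eq_sum hs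
  -- `λ^d η` is a polynomial of degree at most `2d`, shifted back by `d`; the truncation in `toNat`
  -- is never active for `k ≥ -d`.
  refine ⟨hη, h1, fun k => A (k + d).toNat, fun l => ?_⟩
  have hl : (l : ℂ) ≠ 0 := l.coe_ne_zero
  have h2 : η l = ((l : ℂ) ^ d)⁻¹ • ((l : ℂ) ^ d • η l) := by
    rw [inv_smul_smul₀ (pow_ne_zero d hl)]
  rw [h2, hA, Finset.smul_sum]
  refine Finset.sum_nbij' (fun k : ℕ => (k : ℤ) - d) (fun k => (k + d).toNat) ?_ ?_ ?_ ?_ ?_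
  · intro k hk
    simp only [Finset.mem_range, Finset.mem_Icc] at *
    omega
  · intro k hk
    simp only [Finset.mem_range, Finset.mem_Icc] at *
    omega
  · intro k _
    simp
  · intro k hk
    simp only [Finset.mem_Icc] at *
    omega
  · intro k _
    rw [smul_smul, zpow_sub₀ hl, zpow_natCast, zpow_natCast, div_eq_inv_mul]
    congr 2
    simp

/-! ### Existence of the transformed map -/

lemma contDiff_imageProjection {g : ℂ → Mat n} (hg : ContDiff ℝ ∞ g) (hu : ∀ z, IsUnit (g z))
    {P : Mat n} (hP : P * P = P) (hPH : Pᴴ = P) :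
    ContDiff ℝ ∞ fun z => imageProjection (g z) P := by
  have hgH := contDiff_conjTranspose hg
  have hN : ContDiff ℝ ∞ fun z => P * ((g z)ᴴ * g z) * P + (1 - P) :=
    ((contDiff_const.mul (hgH.mul hg)).mul contDiff_const).add contDiff_const
  exact ((hg.mul contDiff_const).mul
    (contDiff_matrix_inv hN fun z => isUnit_compression (hu z) hP hPH)).mul
    (contDiff_const.mul hgH)

/-- Conjugating a loop in `Λ₊G^ℂ` by the loops of projections `P` and `W` gives a loop in `Λ₊G^ℂ`
if `W` is the image of `P` under the value of the loop at `0`. -/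
lemma ExtendsToDisc.projLoop_mul_mul {γ : Circle → Mat n} {f : ℂ → Mat n} {P W k : Mat n}
    (hf : DiffContOnCl ℂ f (Metric.ball 0 1))
    (hfG : ∀ w ∈ Metric.ball (0 : ℂ) 1, f w ∈ complexification G) (hfγ : ∀ l : Circle, f l = γ l)
    (hPP : P * P = P) (hP : ∀ w : ℂ, w ≠ 0 → projLoop P w ∈ complexification G)
    (hk : k ∈ matrices G) (hW : W = k * P * kᴴ) (hWf : W * (f 0 * P) = f 0 * P) :
    ExtendsToDisc (fun l => projLoop W (l : ℂ)⁻¹ * γ l * projLoop P (l : ℂ))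
      (complexification G) := by
  have hWG : ∀ w : ℂ, w ≠ 0 → projLoop W w ∈ complexification G := fun w hw => by
    rw [hW, projLoop_conj k P (mul_conjTranspose_self_of_mem hk)]
    exact mul_mem_complexification (mul_mem_complexification (matrices_subset_complexification hk)
      (hP w hw)) (matrices_subset_complexification (conjTranspose_mem_matrices hk))
  -- The four blocks of the conjugated loop. Only the last carries `w⁻¹`; since `(1 - W) * f 0 * P =
  -- 0`, it is a difference quotient and `dslope` fills in its value at `0`.
  set F : ℂ → Mat n := fun w => W * f w * P + w • (W * f w * (1 - P)) + (1 - W) * f w * (1 - P)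
    + (1 - W) * dslope f 0 w * P with hF
  have hslope := diffContOnCl_dslope hf
  have hFd : DiffContOnCl ℂ F (Metric.ball 0 1) := by
    constructor
    · have h1 := hf.1
      have h2 := hslope.1
      fun_prop
    · have h1 := hf.2
      have h2 := hslope.2
      fun_prop
  have hFne : ∀ w : ℂ, w ≠ 0 → F w = projLoop W w⁻¹ * f w * projLoop P w := fun w hw => by
    have h1 : (1 - W) * dslope f 0 w * P = w⁻¹ • ((1 - W) * f w * P) := by
      have h0 : (1 - W) * f 0 * P = 0 := by
        rw [mul_assoc, sub_mul, hWf, one_mul, sub_self]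
      rw [dslope_of_ne _ hw, slope_def_module, sub_zero, Matrix.mul_smul, Matrix.smul_mul,
        Matrix.mul_sub, Matrix.sub_mul, h0, sub_zero]
    simp only [hF, h1, projLoop, add_mul, mul_add, Matrix.smul_mul, Matrix.mul_smul, smul_smul,
      mul_inv_cancel₀ hw, one_smul]
    abel
  have hFG : ∀ w ∈ Metric.ball (0 : ℂ) 1, w ≠ 0 → F w ∈ complexification G := fun w hw hw0 => by
    rw [hFne w hw0]
    exact mul_mem_complexification (mul_mem_complexification (hWG _ (inv_ne_zero hw0)) (hfG w hw))
      (hP w hw0)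
  have hdet : ∀ w : ℂ, w ≠ 0 → (F w).det = (f w).det := fun w hw => by
    have hkd : k.det * kᴴ.det = 1 := by
      rw [← Matrix.det_mul, mul_conjTranspose_self_of_mem hk, Matrix.det_one]
    have hPd : (projLoop P w⁻¹).det * (projLoop P w).det = 1 := by
      rw [← Matrix.det_mul, projLoop_inv_mul hPP hw, Matrix.det_one]
    rw [hFne w hw, hW, projLoop_conj k P (mul_conjTranspose_self_of_mem hk)]
    simp only [Matrix.det_mul]
    linear_combination (f w).det * ((projLoop P w⁻¹).det * (projLoop P w).det * hkd + hPd)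
  have h0 : (0 : ℂ) ∈ Metric.ball (0 : ℂ) 1 := Metric.mem_ball_self one_pos
  have hcF : ContinuousAt F 0 := (hFd.differentiableAt Metric.isOpen_ball h0).continuousAt
  have hcf : ContinuousAt f 0 := (hf.differentiableAt Metric.isOpen_ball h0).continuousAt
  have hnear : ∀ {u v : ℂ → ℂ}, ContinuousAt u 0 → ContinuousAt v 0 →
      (∀ w ∈ Metric.ball (0 : ℂ) 1, w ≠ 0 → u w = v w) → u 0 = v 0 := by
    intro u v hu hv huv
    refine tendsto_nhds_unique (hu.tendsto.mono_left nhdsWithin_le_nhds : Filter.Tendsto u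
      (nhdsWithin 0 {0}ᶜ) _) ((hv.tendsto.mono_left nhdsWithin_le_nhds).congr' ?_)
    filter_upwards [self_mem_nhdsWithin,
      mem_nhdsWithin_of_mem_nhds (Metric.ball_mem_nhds (0 : ℂ) one_pos)] with w hw hw1
    exact (huv w hw1 hw).symm
  have hcdet : Continuous fun A : Mat n => A.det := by fun_prop
  refine ⟨F, hFd, fun w hw => ?_, fun l => ?_⟩
  · rcases eq_or_ne w 0 with rfl | hw0
    -- At `w = 0` the polynomial equations pass to the limit. Invertibility does not, but
    -- conjugation leaves `det (f w)` unchanged, and this is nonzero at `0`.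
    · refine mem_complexification_iff.2 ⟨?_, fun p hp => ?_⟩
      · rw [Matrix.isUnit_iff_isUnit_det]
        have := hnear (u := fun w => (F w).det) (v := fun w => (f w).det)
          (hcdet.continuousAt.comp hcF) (hcdet.continuousAt.comp hcf) fun w _ hw => hdet w hw
        rw [this]
        exact (Matrix.isUnit_iff_isUnit_det _).1 (hfG 0 hw).1
      · exact hnear (u := fun w => polyAt p (F w)) (v := fun _ => 0)
          ((continuous_polyAt p).continuousAt.comp hcF) continuousAt_const
          fun w hw hw0 => (hFG w hw hw0).2 p hp
    · exact hFG w hw hw0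
  · rw [hFne _ l.coe_ne_zero, hfγ]

/-- The value at `λ = 0` of a smooth family of loops that extend to the disc is smooth. -/
lemma IsSmooth.contDiff_center {b : LoopFamily n} (hb : IsSmooth b) {f : ℂ → ℂ → Mat n}
    (hf : ∀ z, DiffContOnCl ℂ (f z) (Metric.ball 0 1)) (hfb : ∀ z (l : Circle), f z l = b z l) :
    ContDiff ℝ ∞ fun z => f z 0 := by
  have h : ∀ z, f z 0 = (2 * Real.pi)⁻¹ • ∫ t in (0 : ℝ)..2 * Real.pi, b z (Circle.exp t) :=
    fun z => by rw [← integral_exp_eq (hf z)]; simp only [hfb]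
  simp only [h]
  exact (contDiff_intervalIntegral_param (F := fun p : ℂ × ℝ => b p.1 (Circle.exp p.2)) hb 0
    (2 * Real.pi)).const_smul _

/-- The loop of `W(z)` and its inverse are inserted between `Φ` and `b`, with `W(z)` the projection
onto the image of `V` under `b(z)(0)`. -/
lemma exists_isIwasawaFactorOf_gaugeAction
    (hG : IsClosed (G : Set (Matrix.unitaryGroup (Fin n) ℂ))) {μ : LoopForm n} {Φ : LoopFamily n}
    (hΦ : IsIwasawaFactorOf G μ Φ) (V : Submodule ℂ (EuclideanSpace ℂ (Fin n)))
    (hV : ∀ l : Circle, projLoop (hermitianProjection V) (l : ℂ) ∈ complexification G) :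
    ∃ Φ', IsIwasawaFactorOf G (gaugeAction (unitonLoop V) μ) Φ' := by
  obtain ⟨⟨⟨hΦs, hΦG⟩, hΦ1⟩, Ψ, b, ⟨⟨hΨs, hΨG⟩, hΨ0, hΨμ⟩, ⟨⟨hbs, hbG⟩, hbext⟩, hΨ⟩ := hΦ
  set P := hermitianProjection V with hPdef
  have hPP : P * P = P := hermitianProjection_mul_self V
  have hPH : Pᴴ = P := hermitianProjection_conjTranspose V
  have hP : ∀ w : ℂ, w ≠ 0 → projLoop P w ∈ complexification G := fun w hw =>
    add_smul_mem_complexification hPP hV hw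
  have hPG : ∀ l : Circle, projLoop P (l : ℂ) ∈ matrices G := projLoop_mem_matrices hG hPP hPH hV
  have hPG' : ∀ l : Circle, projLoop P (l : ℂ)⁻¹ ∈ matrices G := fun l => by
    rw [← Circle.coe_inv]; exact hPG _
  choose f hf hfG hfb using hbext
  have h0 : (0 : ℂ) ∈ Metric.ball (0 : ℂ) 1 := Metric.mem_ball_self one_pos
  have hex : ∀ z, ∃ k ∈ matrices G, imageProjection (f z 0) P = k * P * kᴴ ∧
      k * P * kᴴ * (f z 0 * P) = f z 0 * P := fun z =>
    exists_imageProjection_eq hG (hfG z 0 h0) hPP hPH hP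
  choose k hk hkW hkf using hex
  -- The `k z` are chosen pointwise, with no continuity in `z`. They only show that the loop of `W`
  -- lies in `G`; smoothness rests on the formula for `imageProjection`.
  set W : ℂ → Mat n := fun z => imageProjection (f z 0) P with hW
  have hWs : ContDiff ℝ ∞ W :=
    contDiff_imageProjection (hbs.contDiff_center hf hfb) (fun z => (hfG z 0 h0).1) hPP hPH
  have hWloop : ∀ z w, projLoop (W z) w = k z * projLoop P w * (k z)ᴴ := fun z w => by
    rw [← projLoop_conj _ _ (mul_conjTranspose_self_of_mem (hk z)), ← hkW]
  have hWW : ∀ z, W z * W z = W z := fun z => by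
    have h := conjTranspose_mul_self_of_mem (hk z)
    calc W z * W z = k z * P * ((k z)ᴴ * k z) * P * (k z)ᴴ := by
          simp only [hW, hkW, mul_assoc]
      _ = W z := by rw [h, mul_one, mul_assoc (k z), hPP]; exact (hkW z).symm
  have hWG : ∀ z (l : Circle), projLoop (W z) (l : ℂ) ∈ matrices G := fun z l => by
    rw [hWloop]
    exact mul_mem_matrices (mul_mem_matrices (hk z) (hPG l)) (conjTranspose_mem_matrices (hk z))
  have hWG' : ∀ z (l : Circle), projLoop (W z) (l : ℂ)⁻¹ ∈ matrices G := fun z l => by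
    rw [← Circle.coe_inv]; exact hWG _ _
  have hPs := IsSmooth.projLoop (contDiff_const (c := P))
  have hPs' := IsSmooth.projLoop_inv (contDiff_const (c := P))
  have hPinv : ∀ l : Circle, projLoop P (l : ℂ)⁻¹ * projLoop P (l : ℂ) = 1 := fun l =>
    projLoop_inv_mul hPP l.coe_ne_zero
  have hPinv' : ∀ l : Circle, projLoop P (l : ℂ) * projLoop P (l : ℂ)⁻¹ = 1 := fun l =>
    projLoop_mul_inv hPP l.coe_ne_zero
  refine ⟨fun z l => projLoop P (l : ℂ)⁻¹ * Φ z l * projLoop (W z) l, ⟨⟨?_, fun z l => ?_⟩,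
    fun z => ?_⟩, fun z l => projLoop P (l : ℂ)⁻¹ * Ψ z l * projLoop P l,
    fun z l => projLoop (W z) (l : ℂ)⁻¹ * b z l * projLoop P l,
    ⟨⟨?_, fun z l => ?_⟩, fun l => ?_, fun z l => ?_⟩, ⟨⟨?_, fun z l => ?_⟩, fun z => ?_⟩,
    fun z l => ?_⟩
  · exact (hPs'.mul hΦs).mul (IsSmooth.projLoop hWs)
  · exact mul_mem_matrices (mul_mem_matrices (hPG' l) (hΦG z l)) (hWG z l)
  · simp [hΦ1]
  · exact (hPs'.mul hΨs).mul hPs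
  · exact mul_mem_complexification (mul_mem_complexification (hP _ (inv_ne_zero l.coe_ne_zero))
      (hΨG z l)) (hP _ l.coe_ne_zero)
  · change projLoop P (l : ℂ)⁻¹ * Ψ 0 l * projLoop P l = 1
    rw [hΨ0, mul_one, hPinv]
  · have hΨd := hΨs.differentiableAt l z
    have hγ : (projLoop P (l : ℂ)⁻¹)⁻¹ = projLoop P (l : ℂ) := Matrix.inv_eq_right_inv (hPinv l)
    have hγ' : (projLoop P (l : ℂ))⁻¹ = projLoop P (l : ℂ)⁻¹ := Matrix.inv_eq_right_inv (hPinv' l)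
    have hcon : ∀ X Y : Mat n, (Ψ z l)⁻¹ * X = Y →
        (projLoop P (l : ℂ)⁻¹ * Ψ z l * projLoop P l)⁻¹ * (projLoop P (l : ℂ)⁻¹ * X * projLoop P l)
          = projLoop P (l : ℂ)⁻¹ * Y * projLoop P l := by
      rintro X _ rfl
      rw [Matrix.mul_inv_rev, Matrix.mul_inv_rev, hγ, hγ']
      calc _ = projLoop P (l : ℂ)⁻¹ * (Ψ z l)⁻¹ * (projLoop P l * projLoop P (l : ℂ)⁻¹) * X
            * projLoop P l := by simp only [mul_assoc]
        _ = _ := by rw [hPinv', mul_one]; simp only [mul_assoc]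
    simp only [gaugeAction, unitonLoop_eq, ← hPdef, dZ_const, dZbar_const, zero_mul, sub_zero, hγ]
    constructor
    · rw [dZ_const_mul_mul_const hΨd]
      exact hcon _ _ (hΨμ z l).1
    · rw [dZbar_const_mul_mul_const hΨd]
      exact hcon _ _ (hΨμ z l).2
  · exact ((IsSmooth.projLoop_inv hWs).mul hbs).mul hPs
  · exact mul_mem_complexification (mul_mem_complexification
      (matrices_subset_complexification (hWG' z l)) (hbG z l)) (hP _ l.coe_ne_zero)
  · exact ExtendsToDisc.projLoop_mul_mul (hf z) (hfG z) (hfb z) hPP hP (hk z) (hkW z)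
      ((congrArg (· * (f z 0 * P)) (hkW z)).trans (hkf z))
  · change projLoop P (l : ℂ)⁻¹ * Ψ z l * projLoop P l = projLoop P (l : ℂ)⁻¹ * Φ z l *
      projLoop (W z) l * (projLoop (W z) (l : ℂ)⁻¹ * b z l * projLoop P l)
    rw [hΨ]
    calc _ = projLoop P (l : ℂ)⁻¹ * Φ z l * 1 * b z l * projLoop P l := by
          simp only [mul_assoc, one_mul]
      _ = _ := by
        rw [← projLoop_mul_inv (hWW z) l.coe_ne_zero]
        simp only [mul_assoc]

end

end LoopHarmonic

end

/-! ### The transformed map is again of finite type -/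

open LoopHarmonic
theorem mainTheorem6 (n : ℕ) (G : Subgroup (Matrix.unitaryGroup (Fin n) ℂ))
    (hG : IsClosed (G : Set (Matrix.unitaryGroup (Fin n) ℂ)))
    (d : ℕ) (hd : Odd d) (η : Circle → Mat n) (hη : η ∈ polynomialLoops G d)
    (φ : ℂ → Mat n) (hφ : IsHarmonicMapOf G (finiteTypePotential d η) φ)
    (V : Submodule ℂ (EuclideanSpace ℂ (Fin n)))
    (hV : unitonLoop V ∈ admissibleGauges G (finiteTypePotential d η)) :
    ∃ φ' : ℂ → Mat n,
      IsHarmonicMapOf G (gaugeAction (unitonLoop V) (finiteTypePotential d η)) φ' ∧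
      (∀ φ'' : ℂ → Mat n,
        IsHarmonicMapOf G (gaugeAction (unitonLoop V) (finiteTypePotential d η)) φ'' → φ'' = φ') ∧
      IsOfFiniteType G φ' := by
  obtain ⟨Φ, hΦ, -⟩ := hφ
  obtain ⟨⟨-, hVG⟩, ⟨-, hVext⟩, -⟩ := hV
  set P := hermitianProjection V with hPdef
  have hPP : P * P = P := hermitianProjection_mul_self V
  have hPH : Pᴴ = P := hermitianProjection_conjTranspose V
  have hPC : ∀ l : Circle, projLoop P (l : ℂ) ∈ complexification G := fun l => by
    have := hVG 0 l⁻¹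
    rwa [unitonLoop_eq, Circle.coe_inv, inv_inv] at this
  obtain ⟨Φ', hΦ'⟩ := exists_isIwasawaFactorOf_gaugeAction hG hΦ V hPC
  refine ⟨fun z => Φ' z (Circle.exp Real.pi), ⟨Φ', hΦ', fun z => rfl⟩, ?_, ?_⟩
  · rintro φ'' ⟨Φ'', hΦ'', hφ''⟩
    ext1 z
    rw [hφ'', iwasawaFactor_unique hΦ'' hΦ']
  · set η' : Circle → Mat n := fun l => projLoop P (l : ℂ)⁻¹ * η l * projLoop P (l : ℂ) with hη'
    have hgauge : gaugeAction (unitonLoop V) (finiteTypePotential d η) = finiteTypePotential d η' :=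
      gaugeAction_unitonLoop V d η
    rw [hgauge] at hΦ' hVext
    have hext : DiscExt fun l : Circle => (l : ℂ) • (finiteTypePotential d η').zPart 0 l :=
      (hVext 0).discExt
    have hes : IsExtendedSolution G Φ' :=
      isExtendedSolution_of_isIwasawaFactorOf hG (fun _ => hext) (fun _ => discExt_const 0) hΦ'
    -- Values stay in the Lie algebra because the conjugating loop lies in `G`. The degree bound is
    -- where membership in `S_μ` enters, through `λ · λ^{d-1} = λ^d`, which needs `d ≥ 1`.
    have hη'd : η' ∈ polynomialLoops G d := by
      refine mem_polynomialLoops (fun l => ?_) ?_ ?_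
      · have h := conj_mem_lieAlg (projLoop_mem_matrices hG hPP hPH hPC l⁻¹) (hη.1 l)
        rwa [projLoop_conjTranspose hPH, Circle.coe_inv, inv_inv] at h
      · simp [hη', hη.2.1]
      · convert hext using 2 with l
        rw [finiteTypePotential, smul_smul, ← pow_succ', Nat.sub_add_cancel hd.pos]
    exact ⟨hes.isHarmonic, d, hd, η', hη'd, Φ', hes, hΦ', fun z => rfl⟩
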